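/- A linear pencil is an operator function $A(z)=A_0+zA_1$ with bounded coefficients $A_0,A_1$; on a complex Hilbert space it is contractive (resp. unitary) if $A(\lambda)$ is a contraction (resp. unitary) for every $\lambda\in\mathbb T=\{|\lambda|=1\}$. If $\mathcal H\subset\widetilde{\mathcal H}$, a pencil $\widetilde T$ on $\widetilde{\mathcal H}$ is a dilation of a pencil $T$ on $\mathcal H$ if $T(\lambda)^n=P_{\mathcal H}\widetilde T(\lambda)^n|\mathcal H$ for all $\lambda\in\mathbb T$, $n\ge 0$; it is uniform if moreover $T_{j_1}\cdots T_{j_n}=P_{\mathcal H}\widetilde T_{j_1}\cdots\widetilde T_{j_n}|\mathcal H$ for all $n$ and $j_1,\dots,j_n\in\{0,1\}$. A unitary dilation of a contractive pencil is a dilation that is a unitary pencil. A minimal (uniform) unitary dilation of $T$ is a minimal element among all (uniform) unitary dilations of $T$ for the order in which $T'\le\widetilde T$ means that $T'$ acts on a closed subspace $\mathcal H'$ with $\mathcal H\subset\mathcal H'\subset\widetilde{\mathcal H}$ and $\widetilde T$ is a dilation of $T'$. For a Hilbert space $\mathcal X$, $H^2_{\mathcal X}(\mathbb D)$ is the space of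 holomorphic $x:\mathbb D\to\mathcal X$ with $\|x\|^2=\frac1{2\pi}\sup_{0<r<1}\int_0^{2\pi}\|x(re^{is})\|^2ds<\infty$; a contractive holomorphic function $\theta:\mathbb D\to[\mathcal X,\mathcal Y]$ is outer if $\theta H^2_{\mathcal X}(\mathbb D)$ is dense in $H^2_{\mathcal Y}(\mathbb D)$. **Theorem.** Let $T(\lambda)=T_0+\lambda T_1$ be a contractive linear pencil on a separable complex Hilbert space $\mathcal H$. (a) There are a separable Hilbert space $\mathcal Y$ and a linear outer function $F(z)=F_0+zF_1$ with values in $[\mathcal H,\mathcal Y]$ such that $F(\lambda)^*F(\lambda)=I-T(\lambda)^*T(\lambda)$ for all $\lambda\in\mathbb T$. (b) Let $\mathcal Y$, $F$ be any such pair. On $\mathcal K_+=\big(\bigoplus_{-\infty}^{-1}\mathcal Y\big)\oplus\mathcal H$ let $V(\lambda)=V_0+\lambda V_1$ be the pencil sending the column $(\dots,y_{-2},y_{-1},h)$ to $(\dots,y_{-2},y_{-1},F(\lambda)h,T(\lambda)h)$. Put $\mathcal V=\bigvee_{\lambda\in\mathbb T}V(\lambda)\mathcal K_+$, $\mathcal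 L=\mathcal K_+\ominus\mathcal V$, $\mathcal K_1=\mathcal V\ominus V(1)\mathcal K_+$, $P(\lambda)=P_{\overline{V_0\mathcal K_+}}+\lambda P_{\overline{V_1\mathcal K_+}}$, $\mathcal U=\mathcal K_1\oplus\mathcal L$, and let $Q(\lambda):\mathcal U\to\mathcal K_+$, $Q(\lambda)(k\oplus l)=P(\lambda)k+l$. On $$\mathcal K=\Big(\bigoplus_{-\infty}^{-1}\mathcal Y\Big)\oplus\mathcal H\oplus\Big(\bigoplus_{1}^{\infty}\mathcal U\Big)$$ let $U(\lambda)$ be the linear pencil sending $(\dots,y_{-2},y_{-1},\boxed{h},u_1,u_2,\dots)$ to $$\big(\dots,y_{-2},y_{-1},\,F(\lambda)h+P_{\mathcal Y}Q(\lambda)u_1,\,\boxed{T(\lambda)h+P_{\mathcal H}Q(\lambda)u_1},\,u_2,u_3,\dots\big),$$ where the box marks the $\mathcal H$-component and $P_{\mathcal Y}$, $P_{\mathcal H}$ are the projections of $\mathcal K_+$ onto its $(-1)$-st copy of $\mathcal Y$ and onto $\mathcal H$. Then, with $\mathcal H$ embedded in $\mathcal K$ as the $\mathcal H$-component, $U(\lambda)$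 is a minimal unitary dilation of $T(\lambda)$, and it is moreover a minimal uniform unitary dilation of $T(\lambda)$. -/

import Mathlib

open scoped ENNReal InnerProductSpace

universe u v w

noncomputable section

namespace PencilDilation

/-! ## Linear pencils and their dilations -/

/-- A linear pencil `A(z) = A₀ + z A₁` of bounded operators from `E` to `F`,
given by its two coefficients. -/
structure LinearPencil (E : Type u) (F : Type v)
    [NormedAddCommGroup E] [InnerProductSpace ℂ E]
    [NormedAddCommGroup F] [InnerProductSpace ℂ F] where
  coeff : Fin 2 → E →L[ℂ] F

namespace LinearPencil

variable {E : Type u} {F : Type v} [NormedAddCommGroup E] [InnerProductSpace ℂ E]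
  [NormedAddCommGroup F] [InnerProductSpace ℂ F]

/-- The value `A(z) = A₀ + z A₁`. -/
def eval (A : LinearPencil E F) (z : ℂ) : E →L[ℂ] F :=
  A.coeff 0 + z • A.coeff 1

/-- `A(ζ)` is a contraction for every `ζ` on the unit circle. -/
def IsContractive (A : LinearPencil E F) : Prop :=
  ∀ ζ : Circle, ‖A.eval ζ‖ ≤ 1

/-- `A(ζ)` is a unitary operator for every `ζ` on the unit circle. -/
def IsUnitary [CompleteSpace E] (A : LinearPencil E E) : Prop :=
  ∀ ζ : Circle, A.eval ζ ∈ unitary (E →L[ℂ] E)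

end LinearPencil

section Dilation

variable {H : Type u} {K : Type v} [NormedAddCommGroup H] [InnerProductSpace ℂ H] [CompleteSpace H]
  [NormedAddCommGroup K] [InnerProductSpace ℂ K] [CompleteSpace K]

/-- The compression `P_H A|H` of an operator `A` on `K`, where `H` is regarded as a subspace of `K`
through the isometric embedding `ι`. The adjoint of `ι` is the orthogonal projection onto `ι(H)`
followed by the identification of `ι(H)` with `H`. -/
def compression (ι : H →ₗᵢ[ℂ] K) (A : K →L[ℂ] K) : H →L[ℂ] H :=
  (ContinuousLinearMap.adjoint ι.toContinuousLinearMap) ∘L A ∘L ι.toContinuousLinearMap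

/-- `T'` (on `K ⊇ H`) is a dilation of `T` (on `H`):
`T(ζ)ⁿ = P_H T'(ζ)ⁿ|H` for all unimodular `ζ` and all `n ≥ 0`. -/
def IsDilation (ι : H →ₗᵢ[ℂ] K) (T : LinearPencil H H) (T' : LinearPencil K K) : Prop :=
  ∀ (ζ : Circle) (n : ℕ), T.eval ζ ^ n = compression ι (T'.eval ζ ^ n)

/-- The dilation `T'` of `T` is uniform:
`T_{j₁} ⋯ T_{jₙ} = P_H T'_{j₁} ⋯ T'_{jₙ}|H` for all words in the coefficients. -/
def IsUniformDilation (ι : H →ₗᵢ[ℂ] K) (T : LinearPencil H H) (T' : LinearPencil K K) : Prop :=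
  IsDilation ι T T' ∧
    ∀ j : List (Fin 2), (j.map T.coeff).prod = compression ι (j.map T'.coeff).prod

/-- `T'` is a unitary dilation of the contractive pencil `T`. -/
def IsUnitaryDilation (ι : H →ₗᵢ[ℂ] K) (T : LinearPencil H H) (T' : LinearPencil K K) : Prop :=
  T.IsContractive ∧ T'.IsUnitary ∧ IsDilation ι T T'

/-- `T'` is a uniform unitary dilation of the contractive pencil `T`. -/
def IsUniformUnitaryDilation (ι : H →ₗᵢ[ℂ] K) (T : LinearPencil H H)
    (T' : LinearPencil K K) : Prop :=
  T.IsContractive ∧ T'.IsUnitary ∧ IsUniformDilation ι T T'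

/-- The embedding of `H` into a subspace `M` of `K` that contains `H`. -/
def embedInto (ι : H →ₗᵢ[ℂ] K) (M : Submodule ℂ K) (hM : ∀ h, ι h ∈ M) : H →ₗᵢ[ℂ] M where
  toLinearMap := ι.toLinearMap.codRestrict M hM
  norm_map' h := ι.norm_map h

/-- `T'` is a minimal element among all unitary dilations of `T`, for the order in which `T'' ≤ T'`
means that `T''` acts on a closed subspace `M` with `H ⊆ M ⊆ K` and `T'` is a dilation of `T''`. -/
def IsMinimalUnitaryDilation (ι : H →ₗᵢ[ℂ] K) (T : LinearPencil H H)
    (T' : LinearPencil K K) : Prop :=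
  IsUnitaryDilation ι T T' ∧
    ∀ (M : Submodule ℂ K) [CompleteSpace M] (hM : ∀ h, ι h ∈ M) (T'' : LinearPencil M M),
      IsUnitaryDilation (embedInto ι M hM) T T'' → IsDilation M.subtypeₗᵢ T'' T' → M = ⊤

/-- `T'` is a minimal element, for the same order, among all uniform unitary dilations of `T`. -/
def IsMinimalUniformUnitaryDilation (ι : H →ₗᵢ[ℂ] K) (T : LinearPencil H H)
    (T' : LinearPencil K K) : Prop :=
  IsUniformUnitaryDilation ι T T' ∧
    ∀ (M : Submodule ℂ K) [CompleteSpace M] (hM : ∀ h, ι h ∈ M) (T'' : LinearPencil M M),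
      IsUniformUnitaryDilation (embedInto ι M hM) T T'' → IsDilation M.subtypeₗᵢ T'' T' → M = ⊤

end Dilation

/-! ## Hardy spaces and outer factors -/

section Hardy

variable {X : Type u} {Y : Type v} [NormedAddCommGroup X] [InnerProductSpace ℂ X]
  [NormedAddCommGroup Y] [InnerProductSpace ℂ Y]

/-- The Hardy norm: `‖x‖² = (2π)⁻¹ sup_{0<r<1} ∫₀^{2π} ‖x(r e^{is})‖² ds`, with values in `[0, ∞]`.
Only the values of `x` in the open unit disk matter. -/
def hardyNorm (x : ℂ → X) : ℝ≥0∞ :=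
  ((ENNReal.ofReal (2 * Real.pi))⁻¹ * ⨆ r ∈ Set.Ioo (0 : ℝ) 1,
    ∫⁻ s in Set.Icc (0 : ℝ) (2 * Real.pi), ‖x (r * Complex.exp (s * Complex.I))‖ₑ ^ 2)
      ^ (1 / 2 : ℝ)

/-- Membership in the Hardy space `H²_X(𝔻)`. -/
def MemHardy (x : ℂ → X) : Prop :=
  DifferentiableOn ℂ x (Metric.ball 0 1) ∧ hardyNorm x < ∞

/-- A contractive holomorphic function `θ : 𝔻 → [X, Y]` is outer if `θ H²_X(𝔻)` is dense in
`H²_Y(𝔻)`. -/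
def IsOuter (θ : ℂ → X →L[ℂ] Y) : Prop :=
  DifferentiableOn ℂ θ (Metric.ball 0 1) ∧
  (∀ z ∈ Metric.ball (0 : ℂ) 1, ‖θ z‖ ≤ 1) ∧
  ∀ y : ℂ → Y, MemHardy y → ∀ ε : ℝ≥0∞, 0 < ε →
    ∃ x : ℂ → X, MemHardy x ∧ hardyNorm (fun z => y z - θ z (x z)) < ε

/-- `F` is a linear outer function with `F(ζ)* F(ζ) = I - T(ζ)* T(ζ)` on the unit circle. -/
def IsOuterFactor [CompleteSpace X] [CompleteSpace Y] (T : LinearPencil X X)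
    (F : LinearPencil X Y) : Prop :=
  IsOuter F.eval ∧ ∀ ζ : Circle,
    ContinuousLinearMap.adjoint (F.eval ζ) ∘L F.eval ζ =
      ContinuousLinearMap.id ℂ X - ContinuousLinearMap.adjoint (T.eval ζ) ∘L T.eval ζ

end Hardy

/-! ## One-sided infinite orthogonal sums -/

/-- The orthogonal sum of countably many copies `X₀ ⊕ X₁ ⊕ ⋯` of `X`. -/
abbrev SeqSum (X : Type u) [NormedAddCommGroup X] [InnerProductSpace ℂ X] : Type u :=
  lp (fun _ : ℕ => X) 2

section Shifts

variable {X : Type u} [NormedAddCommGroup X] [InnerProductSpace ℂ X]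

theorem summable_sq (x : SeqSum X) : Summable fun n => ‖x n‖ ^ 2 := by
  have h := (lp.memℓp x).summable (by norm_num)
  simpa using h

theorem memlp_of_summable_sq {X : Type u} [NormedAddCommGroup X] {f : ℕ → X} (h : Summable fun n => ‖f n‖ ^ 2) :
    Memℓp f 2 := by
  rw [memℓp_gen_iff (by norm_num)]
  simpa using h

theorem norm_sq_tsum (x : SeqSum X) : ‖x‖ ^ 2 = ∑' n, ‖x n‖ ^ 2 := by
  have h := lp.norm_rpow_eq_tsum (p := 2) (by norm_num) x
  simpa using h

/-- The forward shift `(x₀, x₁, …) ↦ (0, x₀, x₁, …)`. -/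
def shiftForward (X : Type u) [NormedAddCommGroup X] [InnerProductSpace ℂ X] :
    SeqSum X →L[ℂ] SeqSum X :=
  LinearMap.mkContinuous
    { toFun := fun x => ⟨fun n => Nat.casesOn n 0 fun m => x m, memlp_of_summable_sq (by
        rw [← summable_nat_add_iff 1]
        exact summable_sq x)⟩
      map_add' := fun x y => by
        ext n
        cases n with
        | zero => exact (add_zero (0 : X)).symm
        | succ m => rfl
      map_smul' := fun c x => by
        ext n
        cases n <;> simp } 1 (fun x => by
      rw [one_mul]
      refine le_of_sq_le_sq ?_ (norm_nonneg _)
      rw [norm_sq_tsum, norm_sq_tsum, Summable.tsum_eq_zero_add]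
      · simp
      · rw [← summable_nat_add_iff 1]
        exact summable_sq x)

/-- The backward shift `(x₀, x₁, …) ↦ (x₁, x₂, …)`. -/
def shiftBackward (X : Type u) [NormedAddCommGroup X] [InnerProductSpace ℂ X] :
    SeqSum X →L[ℂ] SeqSum X :=
  LinearMap.mkContinuous
    { toFun := fun x => ⟨fun n => x (n + 1), memlp_of_summable_sq
        ((summable_nat_add_iff 1).2 (summable_sq x))⟩
      map_add' := fun x y => by
        ext n
        rfl
      map_smul' := fun c x => by
        ext n
        simp } 1 (fun x => by
      rw [one_mul]
      refine le_of_sq_le_sq ?_ (norm_nonneg _)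
      rw [norm_sq_tsum, norm_sq_tsum, (summable_sq x).tsum_eq_zero_add]
      exact le_add_of_nonneg_left (by positivity))

/-- The inclusion `x ↦ (x, 0, 0, …)` of the summand of index `0`. -/
def inclZero (X : Type u) [NormedAddCommGroup X] [InnerProductSpace ℂ X] : X →L[ℂ] SeqSum X :=
  lp.singleContinuousLinearMap ℂ (fun _ : ℕ => X) 2 0

/-- The projection `(x₀, x₁, …) ↦ x₀` onto the summand of index `0`. -/
def projZero (X : Type u) [NormedAddCommGroup X] [InnerProductSpace ℂ X] : SeqSum X →L[ℂ] X :=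
  lp.evalCLM ℂ (fun _ : ℕ => X) 2 0

@[simp] theorem shiftForward_zero (x : SeqSum X) : shiftForward X x 0 = 0 := rfl
@[simp] theorem shiftForward_succ (x : SeqSum X) (n : ℕ) : shiftForward X x (n + 1) = x n := rfl
@[simp] theorem shiftBackward_apply (x : SeqSum X) (n : ℕ) : shiftBackward X x n = x (n + 1) := rfl
@[simp] theorem projZero_apply (x : SeqSum X) : projZero X x = x 0 := rfl
@[simp] theorem inclZero_zero (x : X) : inclZero X x 0 = x := by simp [inclZero]
@[simp] theorem inclZero_succ (x : X) (n : ℕ) : inclZero X x (n + 1) = 0 := by simp [inclZero]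

end Shifts

/-! ## The isometric dilation -/

section IsometricDilation

variable {H : Type u} {Y : Type v} [NormedAddCommGroup H] [InnerProductSpace ℂ H]
  [NormedAddCommGroup Y] [InnerProductSpace ℂ Y]

/-- `K₊ = (⨁_{-∞}^{-1} Y) ⊕ H`. The entry of index `n : ℕ` of the first component is the one at
position `-(n+1)`. -/
abbrev KPlus (Y : Type v) (H : Type u) [NormedAddCommGroup Y] [InnerProductSpace ℂ Y]
    [NormedAddCommGroup H] [InnerProductSpace ℂ H] : Type (max u v) :=
  WithLp 2 (SeqSum Y × H)

/-- The projection of `K₊` onto the copy of `Y` at position `-1`. -/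
def projY (Y : Type v) (H : Type u) [NormedAddCommGroup Y] [InnerProductSpace ℂ Y]
    [NormedAddCommGroup H] [InnerProductSpace ℂ H] : KPlus Y H →L[ℂ] Y :=
  projZero Y ∘L WithLp.fstL 2 ℂ (SeqSum Y) H

/-- The projection of `K₊` onto `H`. -/
def projH (Y : Type v) (H : Type u) [NormedAddCommGroup Y] [InnerProductSpace ℂ Y]
    [NormedAddCommGroup H] [InnerProductSpace ℂ H] : KPlus Y H →L[ℂ] H :=
  WithLp.sndL 2 ℂ (SeqSum Y) H

/-- An operator into an orthogonal sum, from its two components. -/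
def intoSum {E A B : Type*} [NormedAddCommGroup E] [InnerProductSpace ℂ E]
    [NormedAddCommGroup A] [InnerProductSpace ℂ A] [NormedAddCommGroup B] [InnerProductSpace ℂ B]
    (f : E →L[ℂ] A) (g : E →L[ℂ] B) : E →L[ℂ] WithLp 2 (A × B) :=
  (WithLp.prodContinuousLinearEquiv 2 ℂ A B).symm.toContinuousLinearMap ∘L f.prod g

/-- The pencil `V(z)` on `K₊`: the entry at position `-n` moves to position `-(n+1)`,
and `h ∈ H` contributes `F(z) h` at position `-1` and `T(z) h` in `H`. -/
def isomDilation (T : LinearPencil H H) (F : LinearPencil H Y) :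
    LinearPencil (KPlus Y H) (KPlus Y H) where
  coeff := ![
    intoSum
      (shiftForward Y ∘L WithLp.fstL 2 ℂ (SeqSum Y) H + inclZero Y ∘L F.coeff 0 ∘L projH Y H)
      (T.coeff 0 ∘L projH Y H),
    intoSum
      (inclZero Y ∘L F.coeff 1 ∘L projH Y H)
      (T.coeff 1 ∘L projH Y H)]

end IsometricDilation

/-! ## The defect pencil of an isometric pencil -/

section Defect

variable {E : Type u} [NormedAddCommGroup E] [InnerProductSpace ℂ E] [CompleteSpace E]

/-- `𝒱 = ⋁_{|ζ| = 1} V(ζ) E`. -/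
def rangeSpan (V : LinearPencil E E) : Submodule ℂ E :=
  (⨆ ζ : Circle, (V.eval ζ).range).topologicalClosure

/-- `𝓛 = E ⊖ 𝒱`. -/
def spaceL (V : LinearPencil E E) : Submodule ℂ E := (rangeSpan V)ᗮ

/-- `𝒦_ζ = 𝒱 ⊖ V(ζ) E`. -/
def spaceK (V : LinearPencil E E) (ζ : Circle) : Submodule ℂ E :=
  rangeSpan V ⊓ ((V.eval ζ).range)ᗮ

instance instCompleteSpaceL (V : LinearPencil E E) : CompleteSpace (spaceL V) :=
  (Submodule.isClosed_orthogonal _).completeSpace_coe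

instance instCompleteSpaceK (V : LinearPencil E E) (ζ : Circle) : CompleteSpace (spaceK V ζ) :=
  ((Submodule.isClosed_topologicalClosure _).inter
    (Submodule.isClosed_orthogonal _)).completeSpace_coe

/-- `P(z) = P_{closure(V₀ E)} + z P_{closure(V₁ E)}`, as operators on `E`. -/
def diagPencil (V : LinearPencil E E) : LinearPencil E E where
  coeff i := ((V.coeff i).range.topologicalClosure).starProjection

/-- `𝒰 = 𝒦₁ ⊕ 𝓛`. -/
abbrev DefectSpace (V : LinearPencil E E) : Type u := WithLp 2 (spaceK V 1 × spaceL V)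

/-- `Q(z) = [P(z)|𝒦₁  0; 0  I_𝓛] : 𝒰 = 𝒦₁ ⊕ 𝓛 → E`, that is, `Q(z)(k, l) = P(z) k + l`. -/
def defectPencil (V : LinearPencil E E) : LinearPencil (DefectSpace V) E where
  coeff := ![
    (diagPencil V).coeff 0 ∘L (spaceK V 1).subtypeL ∘L WithLp.fstL 2 ℂ (spaceK V 1) (spaceL V)
      + (spaceL V).subtypeL ∘L WithLp.sndL 2 ℂ (spaceK V 1) (spaceL V),
    (diagPencil V).coeff 1 ∘L (spaceK V 1).subtypeL ∘L WithLp.fstL 2 ℂ (spaceK V 1) (spaceL V)]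

theorem defectPencil_eval (V : LinearPencil E E) (z : ℂ) (x : DefectSpace V) :
    (defectPencil V).eval z x = (diagPencil V).eval z x.fst + x.snd := by
  simp [defectPencil, LinearPencil.eval]
  abel

end Defect

/-! ## The unitary dilation -/

section UnitaryDilation

variable {H : Type u} {Y : Type v} {U : Type w}
  [NormedAddCommGroup H] [InnerProductSpace ℂ H]
  [NormedAddCommGroup Y] [InnerProductSpace ℂ Y]
  [NormedAddCommGroup U] [InnerProductSpace ℂ U]

/-- `K = (⨁_{-∞}^{-1} Y) ⊕ H ⊕ (⨁_1^∞ U)`. The entry of index `n : ℕ` of the last component is the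
one at position `n+1`. -/
abbrev KFull (Y : Type v) (H : Type u) (U : Type w)
    [NormedAddCommGroup Y] [InnerProductSpace ℂ Y] [NormedAddCommGroup H] [InnerProductSpace ℂ H]
    [NormedAddCommGroup U] [InnerProductSpace ℂ U] : Type (max u v w) :=
  WithLp 2 (KPlus Y H × SeqSum U)

/-- The component `⨁ Y` of `K`. -/
def compY (Y : Type v) (H : Type u) (U : Type w)
    [NormedAddCommGroup Y] [InnerProductSpace ℂ Y] [NormedAddCommGroup H] [InnerProductSpace ℂ H]
    [NormedAddCommGroup U] [InnerProductSpace ℂ U] : KFull Y H U →L[ℂ] SeqSum Y :=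
  WithLp.fstL 2 ℂ (SeqSum Y) H ∘L WithLp.fstL 2 ℂ (KPlus Y H) (SeqSum U)

/-- The component `H` of `K`. -/
def compH (Y : Type v) (H : Type u) (U : Type w)
    [NormedAddCommGroup Y] [InnerProductSpace ℂ Y] [NormedAddCommGroup H] [InnerProductSpace ℂ H]
    [NormedAddCommGroup U] [InnerProductSpace ℂ U] : KFull Y H U →L[ℂ] H :=
  WithLp.sndL 2 ℂ (SeqSum Y) H ∘L WithLp.fstL 2 ℂ (KPlus Y H) (SeqSum U)

/-- The component `⨁ U` of `K`. -/
def compU (Y : Type v) (H : Type u) (U : Type w)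
    [NormedAddCommGroup Y] [InnerProductSpace ℂ Y] [NormedAddCommGroup H] [InnerProductSpace ℂ H]
    [NormedAddCommGroup U] [InnerProductSpace ℂ U] : KFull Y H U →L[ℂ] SeqSum U :=
  WithLp.sndL 2 ℂ (KPlus Y H) (SeqSum U)

/-- The pencil of block matrices on `K` whose only entries are `F(z) : H → Y₋₁`, `T(z) : H → H`,
`A(z) : U₁ → Y₋₁`, `B(z) : U₁ → H` and the identities `Y₋ₙ → Y₋₍ₙ₊₁₎`, `Uₙ₊₁ → Uₙ` (`n ≥ 1`). -/
def blockPencil (T : LinearPencil H H) (F : LinearPencil H Y)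
    (A : LinearPencil U Y) (B : LinearPencil U H) :
    LinearPencil (KFull Y H U) (KFull Y H U) where
  coeff := ![
    intoSum
      (intoSum
        (shiftForward Y ∘L compY Y H U +
          inclZero Y ∘L (F.coeff 0 ∘L compH Y H U + A.coeff 0 ∘L projZero U ∘L compU Y H U))
        (T.coeff 0 ∘L compH Y H U + B.coeff 0 ∘L projZero U ∘L compU Y H U))
      (shiftBackward U ∘L compU Y H U),
    intoSum
      (intoSum
        (inclZero Y ∘L (F.coeff 1 ∘L compH Y H U + A.coeff 1 ∘L projZero U ∘L compU Y H U))
        (T.coeff 1 ∘L compH Y H U + B.coeff 1 ∘L projZero U ∘L compU Y H U))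
      0]

section Entries

variable (T : LinearPencil H H) (F : LinearPencil H Y) (A : LinearPencil U Y)
  (B : LinearPencil U H) (z : ℂ) (k : KFull Y H U)

/-- Row `-1`. -/
theorem blockPencil_row_Y_zero :
    ((blockPencil T F A B).eval z k).fst.fst 0 =
      F.eval z k.fst.snd + A.eval z (k.snd 0) := by
  change (projZero Y ∘L compY Y H U) ((blockPencil T F A B).eval z k) = _
  simp only [LinearPencil.eval, add_apply, smul_apply, map_add, map_smul]
  simp [blockPencil, intoSum, compY, compH, compU]
  abel

/-- Row `-(n+2)`. -/
theorem blockPencil_row_Y_succ (n : ℕ) :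
    ((blockPencil T F A B).eval z k).fst.fst (n + 1) = k.fst.fst n := by
  change (lp.evalCLM ℂ (fun _ : ℕ => Y) 2 (n + 1) ∘L compY Y H U)
    ((blockPencil T F A B).eval z k) = _
  have e : ∀ x, lp.evalCLM ℂ (fun _ : ℕ => Y) 2 (n + 1) x = x (n + 1) := fun _ => rfl
  simp only [LinearPencil.eval, add_apply, smul_apply, map_add, map_smul]
  simp [e, blockPencil, intoSum, compY, compH, compU]

/-- Row `0`. -/
theorem blockPencil_row_H :
    ((blockPencil T F A B).eval z k).fst.snd =
      T.eval z k.fst.snd + B.eval z (k.snd 0) := by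
  simp [blockPencil, LinearPencil.eval, intoSum, compH, compU]
  abel

/-- Row `n+1`. -/
theorem blockPencil_row_U (n : ℕ) :
    ((blockPencil T F A B).eval z k).snd n = k.snd (n + 1) := by
  simp [blockPencil, LinearPencil.eval, intoSum, compU]

end Entries

/-- The embedding of `H` into `K` at position `0`. -/
def embH (Y : Type v) (H : Type u) (U : Type w)
    [NormedAddCommGroup Y] [InnerProductSpace ℂ Y] [NormedAddCommGroup H] [InnerProductSpace ℂ H]
    [NormedAddCommGroup U] [InnerProductSpace ℂ U] : H →ₗᵢ[ℂ] KFull Y H U where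
  toLinearMap := (intoSum (intoSum 0 (ContinuousLinearMap.id ℂ H)) 0 : H →L[ℂ] KFull Y H U)
  norm_map' h := by
    change ‖WithLp.toLp 2 (WithLp.toLp 2 ((0 : SeqSum Y), h), (0 : SeqSum U))‖ = ‖h‖
    rw [WithLp.norm_toLp_fst, WithLp.norm_toLp_snd]

end UnitaryDilation

section Construction

variable {H : Type u} {Y : Type v}
  [NormedAddCommGroup H] [InnerProductSpace ℂ H] [CompleteSpace H]
  [NormedAddCommGroup Y] [InnerProductSpace ℂ Y] [CompleteSpace Y]

/-- The pencil `Q(z) : 𝒰 → K₊` of the isometric pencil `V(z)` built from `T` and `F`. -/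
def pencilQ (T : LinearPencil H H) (F : LinearPencil H Y) :
    LinearPencil (DefectSpace (isomDilation T F)) (KPlus Y H) :=
  defectPencil (isomDilation T F)

/-- The space `K = (⨁_{-∞}^{-1} Y) ⊕ H ⊕ (⨁_1^∞ 𝒰)`. -/
abbrev DilationSpace (T : LinearPencil H H) (F : LinearPencil H Y) : Type (max u v) :=
  KFull Y H (DefectSpace (isomDilation T F))

/-- The pencil `U(z)` of block operators on `K`, with blocks `F(z)`, `P_Y Q(z)`, `T(z)`,
`P_H Q(z)` and identities. -/
def unitaryDilation (T : LinearPencil H H) (F : LinearPencil H Y) :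
    LinearPencil (DilationSpace T F) (DilationSpace T F) :=
  blockPencil T F
    ⟨fun i => projY Y H ∘L (pencilQ T F).coeff i⟩
    ⟨fun i => projH Y H ∘L (pencilQ T F).coeff i⟩

end Construction

end PencilDilation

end

/-! Unitarity. The identity F(ζ)*F(ζ) + T(ζ)*T(ζ) = I makes V(ζ) isometric on K₊. Since ⟪V(ζ)x,
V(ζ)y⟫ does not depend on ζ, its Fourier coefficients of index ±1 vanish, so V₀ and V₁ have
orthogonal ranges (`inner_coeff`). Hence on 𝒱 the operators P(ζ) preserve inner products, satisfy
P(ζ)P(ω) = P(ζω) and P(1) = I, and P(ζ)V(1) = V(ζ). They therefore carry 𝒦₁ onto 𝒦_ζ, so Q(ζ) maps 𝒰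
isometrically onto the orthogonal complement of V(ζ)K₊ (`inner_defectPencil`, `norm_defectPencil`,
`exists_defectPencil`). With respect to K₊ ⊕ ⨁𝒰, U(ζ) acts as V(ζ) on K₊, as Q(ζ) on the first copy
of 𝒰, and as a shift on the other copies; this is unitary. The dilation property, also for words in
the coefficients, is read off from the triangular block form.

Minimality. If a unitary pencil S on M ∋ ιh is dilated by U, then S(ζ)m is the projection of U(ζ)m
and has the same norm, so U(ζ) extends S(ζ) and M reduces every U(ζ). Then M contains U₀h, hence F₀h
at position -1. Evaluating an outer function at 0 shows that F₀ has dense range, so M contains every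
copy of Y, then K₊, and, by going backwards along U, every copy of 𝒰 (`eq_top_of_reducing`).

Existence of F. On L²(𝕋; H), multiplication M by T(ζ) is a contraction commuting with the bilateral
shift S, and so Δ = (I - M*M)^{1/2} commutes with S. Let δ be Δ restricted to constants. The
correlations ⟪δh, S^k δh'⟫ are the Fourier coefficients of I - T*T and vanish for k ≥ 2. Thus, in
the closed span of the S^j δH with j ≥ 0, the vector δh has components only in the wandering space W
and in SW: δh = F₀h + S F₁h. Comparing correlations gives F*F = I - T*T, and the density of the span
of the S^j δH is exactly the outerness of F (`woldPencil_approx`, `isOuter_of_approx`). -/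

namespace PencilDilation

/-! ### Isometric pencils and the defect pencil. -/

section Isometric

variable {E : Type u} [NormedAddCommGroup E] [InnerProductSpace ℂ E]

theorem LinearPencil.eval_apply {A B : Type*} [NormedAddCommGroup A] [InnerProductSpace ℂ A]
    [NormedAddCommGroup B] [InnerProductSpace ℂ B] (P : LinearPencil A B) (z : ℂ) (x : A) :
    P.eval z x = P.coeff 0 x + z • P.coeff 1 x := by
  simp [LinearPencil.eval]

theorem Circle.mul_conj_coe (ζ : Circle) : (ζ : ℂ) * starRingEnd ℂ ζ = 1 := by
  simp [Complex.mul_conj]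

/-- The values on the circle are isometries. -/
def LinearPencil.IsIsometric (V : LinearPencil E E) : Prop :=
  ∀ (ζ : Circle) (x : E), ‖V.eval ζ x‖ = ‖x‖

theorem LinearPencil.IsIsometric.inner_map {V : LinearPencil E E} (hV : V.IsIsometric)
    (ζ : Circle) (x y : E) : ⟪V.eval ζ x, V.eval ζ y⟫_ℂ = ⟪x, y⟫_ℂ :=
  (LinearMap.norm_map_iff_inner_map_map (V.eval ζ)).1 (hV ζ) x y

/-- The coefficients of an isometric pencil have orthogonal ranges. -/
theorem LinearPencil.IsIsometric.inner_coeff {V : LinearPencil E E} (hV : V.IsIsometric)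
    (x y : E) : ⟪V.coeff 0 x, V.coeff 1 y⟫_ℂ = 0 := by
  have key : ∀ ζ : Circle, ⟪V.coeff 0 x, V.coeff 0 y⟫_ℂ + ζ * ⟪V.coeff 0 x, V.coeff 1 y⟫_ℂ
      + starRingEnd ℂ ζ * ⟪V.coeff 1 x, V.coeff 0 y⟫_ℂ + ⟪V.coeff 1 x, V.coeff 1 y⟫_ℂ
      = ⟪x, y⟫_ℂ := by
    intro ζ
    rw [← hV.inner_map ζ x y]
    simp only [LinearPencil.eval_apply, inner_add_left, inner_add_right, inner_smul_left,
      inner_smul_right]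
    linear_combination (-⟪V.coeff 1 x, V.coeff 1 y⟫_ℂ) * Circle.mul_conj_coe ζ
  -- A trigonometric polynomial of degree one is determined by its values at the fourth roots of
  -- unity; the combination below extracts the coefficient of ζ.
  have h1 := key 1
  have h2 := key (-1)
  have h3 := key ⟨Complex.I, by simp [Submonoid.unitSphere]⟩
  have h4 := key ⟨-Complex.I, by simp [Submonoid.unitSphere]⟩
  simp only [Circle.coe_one, Circle.coe_neg, map_one, map_neg, Complex.conj_I] at h1 h2 h3 h4
  have hI := Complex.I_mul_I
  generalize ⟪V.coeff 0 x, V.coeff 1 y⟫_ℂ = b at *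
  generalize ⟪V.coeff 1 x, V.coeff 0 y⟫_ℂ = c at *
  linear_combination (h1 - h2) / 4 + (-Complex.I) * (h3 - h4) / 4 + (b - c) / 2 * hI

theorem eval_mem_rangeSpan (V : LinearPencil E E) (ζ : Circle) (x : E) :
    V.eval ζ x ∈ rangeSpan V :=
  Submodule.le_topologicalClosure _
    (Submodule.mem_iSup_of_mem ζ (LinearMap.mem_range_self _ x))

/-- The coefficients are the half sum and the half difference of the values at `1` and `-1`. -/
theorem coeff_mem_rangeSpan (V : LinearPencil E E) (i : Fin 2) (x : E) :
    V.coeff i x ∈ rangeSpan V := by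
  have h1 := eval_mem_rangeSpan V 1 ((1 / 2 : ℂ) • x)
  have h2 := eval_mem_rangeSpan V (-1) ((1 / 2 : ℂ) • x)
  fin_cases i
  · convert (rangeSpan V).add_mem h1 h2 using 1
    simp only [LinearPencil.eval_apply, Circle.coe_one, Circle.coe_neg, map_smul, Fin.zero_eta]
    module
  · convert (rangeSpan V).sub_mem h1 h2 using 1
    simp only [LinearPencil.eval_apply, Circle.coe_one, Circle.coe_neg, map_smul, Fin.mk_one]
    module

variable [CompleteSpace E]

theorem diagPencil_coeff_same (V : LinearPencil E E) (i : Fin 2) (x : E) :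
    (diagPencil V).coeff i (V.coeff i x) = V.coeff i x :=
  Submodule.starProjection_eq_self_iff.2
    (Submodule.le_topologicalClosure _ (LinearMap.mem_range_self _ x))

theorem diagPencil_coeff_zero_of_orth (V : LinearPencil E E) (i : Fin 2) {w : E}
    (hw : ∀ x, ⟪V.coeff i x, w⟫_ℂ = 0) : (diagPencil V).coeff i w = 0 := by
  refine (Submodule.starProjection_apply_eq_zero_iff _).2 ?_
  rw [Submodule.orthogonal_closure]
  rintro _ ⟨x, rfl⟩
  exact hw x

theorem diagPencil_coeff_mem (V : LinearPencil E E) (i : Fin 2) (w : E) :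
    (diagPencil V).coeff i w ∈ (V.coeff i).range.topologicalClosure :=
  Submodule.starProjection_apply_mem _ _

variable {V : LinearPencil E E}

/-- Orthogonality of the coefficient ranges gives Pᵢ Vᵢ = Vᵢ and Pᵢ Vⱼ = 0 for i ≠ j. All identities
for P on 𝒱 follow from this one by continuity. -/
theorem LinearPencil.IsIsometric.diagPencil_eval_apply_eval (hV : V.IsIsometric) (z w : ℂ)
    (x : E) : (diagPencil V).eval z (V.eval w x) = V.coeff 0 x + (z * w) • V.coeff 1 x := by
  have h01 : (diagPencil V).coeff 0 (V.coeff 1 x) = 0 :=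
    diagPencil_coeff_zero_of_orth V 0 fun y => hV.inner_coeff y x
  have h10 : (diagPencil V).coeff 1 (V.coeff 0 x) = 0 :=
    diagPencil_coeff_zero_of_orth V 1 fun y => by
      rw [← inner_conj_symm, hV.inner_coeff x y, map_zero]
  simp only [LinearPencil.eval_apply, map_add, map_smul, diagPencil_coeff_same, h01, h10,
    smul_zero, add_zero, zero_add, smul_smul, mul_comm w z]

theorem diagPencil_coeff_mem_rangeSpan (V : LinearPencil E E) (i : Fin 2) (w : E) :
    (diagPencil V).coeff i w ∈ rangeSpan V := by
  refine Submodule.topologicalClosure_minimal (t := rangeSpan V) _ ?_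
    (Submodule.isClosed_topologicalClosure _) (diagPencil_coeff_mem V i w)
  rintro _ ⟨x, rfl⟩
  exact coeff_mem_rangeSpan V i x

theorem diagPencil_eval_mem_rangeSpan (V : LinearPencil E E) (z : ℂ) (w : E) :
    (diagPencil V).eval z w ∈ rangeSpan V := by
  rw [LinearPencil.eval_apply]
  exact (rangeSpan V).add_mem (diagPencil_coeff_mem_rangeSpan V 0 w)
    ((rangeSpan V).smul_mem _ (diagPencil_coeff_mem_rangeSpan V 1 w))

/-- On the span of the ranges, `P(z) P(w) = P(zw)`. -/
theorem LinearPencil.IsIsometric.diagPencil_eval_eval (hV : V.IsIsometric) (z w : ℂ)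
    {x : E} (hx : x ∈ rangeSpan V) :
    (diagPencil V).eval z ((diagPencil V).eval w x) = (diagPencil V).eval (z * w) x := by
  let A := (diagPencil V).eval z ∘L (diagPencil V).eval w - (diagPencil V).eval (z * w)
  have hA : IsClosed (A.ker : Set E) := A.isClosed_ker
  -- Both sides are continuous, so only vectors V(ζ)y need checking; there each side is V₀y + zwζ
  -- V₁y.
  have : rangeSpan V ≤ A.ker := by
    refine Submodule.topologicalClosure_minimal _ (iSup_le fun ζ => ?_) hA
    rintro _ ⟨y, rfl⟩
    have h1 := hV.diagPencil_eval_apply_eval w ζ y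
    have h2 := hV.diagPencil_eval_apply_eval (z * w) ζ y
    have h3 := hV.diagPencil_eval_apply_eval z (w * ζ) y
    rw [LinearPencil.eval_apply V] at h3
    simp only [LinearMap.mem_ker, A]
    change (diagPencil V).eval z ((diagPencil V).eval w (V.eval ζ y)) -
      (diagPencil V).eval (z * w) (V.eval ζ y) = 0
    rw [h1, h2, h3, mul_assoc, sub_self]
  exact sub_eq_zero.1 (this hx)

theorem LinearPencil.IsIsometric.diagPencil_eval_one (hV : V.IsIsometric)
    {x : E} (hx : x ∈ rangeSpan V) : (diagPencil V).eval 1 x = x := by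
  let A := (diagPencil V).eval 1 - ContinuousLinearMap.id ℂ E
  have hA : IsClosed (A.ker : Set E) := A.isClosed_ker
  have : rangeSpan V ≤ A.ker := by
    refine Submodule.topologicalClosure_minimal _ (iSup_le fun ζ => ?_) hA
    rintro _ ⟨y, rfl⟩
    change (diagPencil V).eval 1 (V.eval ζ y) - V.eval ζ y = 0
    rw [hV.diagPencil_eval_apply_eval, one_mul, LinearPencil.eval_apply, sub_self]
  exact sub_eq_zero.1 (this hx)

theorem LinearPencil.IsIsometric.inner_diagPencil_coeff (hV : V.IsIsometric) (x y : E) :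
    ⟪(diagPencil V).coeff 0 x, (diagPencil V).coeff 1 y⟫_ℂ = 0 := by
  have h : (V.coeff 1).range.topologicalClosure ≤ ((V.coeff 0).range.topologicalClosure)ᗮ := by
    rw [Submodule.orthogonal_closure]
    refine Submodule.topologicalClosure_minimal _ ?_ (Submodule.isClosed_orthogonal _)
    rintro _ ⟨b, rfl⟩ _ ⟨a, rfl⟩
    exact hV.inner_coeff a b
  exact h (diagPencil_coeff_mem V 1 y) _ (diagPencil_coeff_mem V 0 x)

/-- The cross terms vanish because P₀ and P₁ have orthogonal ranges, so the left side is independent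
of ζ; at ζ = 1 the operator is the identity on 𝒱. -/
theorem LinearPencil.IsIsometric.inner_diagPencil_eval (hV : V.IsIsometric) (ζ : Circle)
    {x y : E} (hx : x ∈ rangeSpan V) (hy : y ∈ rangeSpan V) :
    ⟪(diagPencil V).eval ζ x, (diagPencil V).eval ζ y⟫_ℂ = ⟪x, y⟫_ℂ := by
  have h : ⟪(diagPencil V).eval ζ x, (diagPencil V).eval ζ y⟫_ℂ =
      ⟪(diagPencil V).eval 1 x, (diagPencil V).eval 1 y⟫_ℂ := by
    have e1 := hV.inner_diagPencil_coeff x y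
    have e2 : ⟪(diagPencil V).coeff 1 x, (diagPencil V).coeff 0 y⟫_ℂ = 0 := by
      rw [← inner_conj_symm, hV.inner_diagPencil_coeff y x, map_zero]
    simp only [LinearPencil.eval_apply, inner_add_left, inner_add_right, inner_smul_left,
      inner_smul_right, e1, e2, one_smul]
    linear_combination ⟪(diagPencil V).coeff 1 x, (diagPencil V).coeff 1 y⟫_ℂ
      * Circle.mul_conj_coe ζ
  rw [h, hV.diagPencil_eval_one hx, hV.diagPencil_eval_one hy]

theorem LinearPencil.IsIsometric.diagPencil_eval_isometricEval (hV : V.IsIsometric)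
    (ζ : Circle) (x : E) : (diagPencil V).eval ζ (V.eval (1 : Circle) x) = V.eval ζ x := by
  rw [hV.diagPencil_eval_apply_eval, Circle.coe_one, mul_one, LinearPencil.eval_apply]

/-- Since V(ζ) = P(ζ)V(1) and P(ζ) preserves inner products on 𝒱, the relation 𝒦₁ ⊥ V(1)E is
transported from 1 to ζ. The 𝓛 part is orthogonal to all of 𝒱. -/
theorem LinearPencil.IsIsometric.inner_defectPencil (hV : V.IsIsometric) (ζ : Circle)
    (x : E) (u : DefectSpace V) : ⟪V.eval ζ x, (defectPencil V).eval ζ u⟫_ℂ = 0 := by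
  have hL : ⟪V.eval ζ x, (u.snd : E)⟫_ℂ = 0 := u.snd.2 _ (eval_mem_rangeSpan V ζ x)
  rw [defectPencil_eval, inner_add_right, hL, add_zero, ← hV.diagPencil_eval_isometricEval,
    hV.inner_diagPencil_eval ζ (eval_mem_rangeSpan V 1 x) u.fst.2.1]
  exact u.fst.2.2 _ (LinearMap.mem_range_self _ x)

theorem LinearPencil.IsIsometric.norm_defectPencil (hV : V.IsIsometric) (ζ : Circle)
    (u : DefectSpace V) : ‖(defectPencil V).eval ζ u‖ = ‖u‖ := by
  rw [← sq_eq_sq₀ (norm_nonneg _) (norm_nonneg _), WithLp.prod_norm_sq_eq_of_L2,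
    defectPencil_eval]
  have h0 : ⟪(diagPencil V).eval ζ (u.fst : E), (u.snd : E)⟫_ℂ = 0 :=
    u.snd.2 _ (diagPencil_eval_mem_rangeSpan V ζ _)
  have h1 := norm_add_sq_eq_norm_sq_add_norm_sq_of_inner_eq_zero _ _ h0
  have h2 : ‖(diagPencil V).eval ζ (u.fst : E)‖ = ‖(u.fst : E)‖ := by
    rw [@norm_eq_sqrt_re_inner ℂ, @norm_eq_sqrt_re_inner ℂ _ _ _ _ (u.fst : E),
      hV.inner_diagPencil_eval ζ u.fst.2.1 u.fst.2.1]
  rw [sq, h1, h2, ← sq, ← sq]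
  rfl

/-- `Q(ζ)` maps onto the orthogonal complement of the range of `V(ζ)`. -/
theorem LinearPencil.IsIsometric.exists_defectPencil (hV : V.IsIsometric) (ζ : Circle)
    {w : E} (hw : ∀ x, ⟪V.eval ζ x, w⟫_ℂ = 0) : ∃ u, (defectPencil V).eval ζ u = w := by
  have : CompleteSpace (rangeSpan V) :=
    (Submodule.isClosed_topologicalClosure _).completeSpace_coe
  obtain ⟨a, ha, l, hl, rfl⟩ := (rangeSpan V).exists_add_mem_mem_orthogonal w
  -- The preimage of the 𝒱-component `a` is P(ζ̄)a, because P(ζ)P(ζ̄) = P(1) is the identity on 𝒱.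
  have hP : (diagPencil V).eval ζ ((diagPencil V).eval (starRingEnd ℂ ζ) a) = a := by
    rw [hV.diagPencil_eval_eval _ _ ha, Circle.mul_conj_coe, hV.diagPencil_eval_one ha]
  have hk : (diagPencil V).eval (starRingEnd ℂ ζ) a ∈ spaceK V 1 := by
    refine ⟨diagPencil_eval_mem_rangeSpan V _ a, ?_⟩
    rintro _ ⟨x, rfl⟩
    change ⟪V.eval (1 : Circle) x, _⟫_ℂ = 0
    rw [← hV.inner_diagPencil_eval ζ (eval_mem_rangeSpan V 1 x)
      (diagPencil_eval_mem_rangeSpan V _ a), hP, hV.diagPencil_eval_isometricEval]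
    have h := hw x
    rwa [inner_add_right, hl _ (eval_mem_rangeSpan V ζ x), add_zero] at h
  refine ⟨WithLp.toLp 2 (⟨_, hk⟩, ⟨l, hl⟩), ?_⟩
  rw [defectPencil_eval]
  change (diagPencil V).eval ζ ((diagPencil V).eval (starRingEnd ℂ ζ) a) + l = a + l
  rw [hP]

end Isometric

/-! ### The entries of V and the unitarity of U. -/

theorem withLp_prod_ext {A B : Type*} {x y : WithLp 2 (A × B)} (h1 : x.fst = y.fst)
    (h2 : x.snd = y.snd) : x = y :=
  WithLp.ofLp_injective 2 (Prod.ext h1 h2)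

section IsometricDilation

variable {H : Type u} {Y : Type v} [NormedAddCommGroup H] [InnerProductSpace ℂ H]
  [NormedAddCommGroup Y] [InnerProductSpace ℂ Y]
  (T : LinearPencil H H) (F : LinearPencil H Y) (z : ℂ) (x : KPlus Y H)

theorem isomDilation_row_Y_zero :
    ((isomDilation T F).eval z x).fst 0 = F.eval z x.snd := by
  change (projZero Y ∘L WithLp.fstL 2 ℂ (SeqSum Y) H) ((isomDilation T F).eval z x) = _
  simp only [LinearPencil.eval, add_apply, smul_apply, map_add, map_smul]
  simp [isomDilation, intoSum, projH]

theorem isomDilation_row_Y_succ (n : ℕ) :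
    ((isomDilation T F).eval z x).fst (n + 1) = x.fst n := by
  change (lp.evalCLM ℂ (fun _ : ℕ => Y) 2 (n + 1) ∘L WithLp.fstL 2 ℂ (SeqSum Y) H)
    ((isomDilation T F).eval z x) = _
  have e : ∀ x, lp.evalCLM ℂ (fun _ : ℕ => Y) 2 (n + 1) x = x (n + 1) := fun _ => rfl
  simp only [LinearPencil.eval, add_apply, smul_apply, map_add, map_smul]
  simp [e, isomDilation, intoSum, projH]

theorem isomDilation_row_H :
    ((isomDilation T F).eval z x).snd = T.eval z x.snd := by
  simp [isomDilation, LinearPencil.eval, intoSum, projH]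

end IsometricDilation

section Factor

variable {H : Type u} {Y : Type v} [NormedAddCommGroup H] [InnerProductSpace ℂ H]
  [NormedAddCommGroup Y] [InnerProductSpace ℂ Y] [CompleteSpace H] [CompleteSpace Y]
  {T : LinearPencil H H} {F : LinearPencil H Y}

/-- `F(ζ)* F(ζ) = I - T(ζ)* T(ζ)` on the unit circle. -/
def IsDefectFactor (T : LinearPencil H H) (F : LinearPencil H Y) : Prop :=
  ∀ ζ : Circle, ContinuousLinearMap.adjoint (F.eval ζ) ∘L F.eval ζ =
    ContinuousLinearMap.id ℂ H - ContinuousLinearMap.adjoint (T.eval ζ) ∘L T.eval ζ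

theorem IsDefectFactor.norm_sq (hF : IsDefectFactor T F) (ζ : Circle) (h : H) :
    ‖F.eval ζ h‖ ^ 2 + ‖T.eval ζ h‖ ^ 2 = ‖h‖ ^ 2 := by
  have e := congrArg (fun A : H →L[ℂ] H => ⟪A h, h⟫_ℂ) (hF ζ)
  simp only [ContinuousLinearMap.comp_apply, ContinuousLinearMap.adjoint_inner_left,
    sub_apply, inner_sub_left, ContinuousLinearMap.id_apply, inner_self_eq_norm_sq_to_K] at e
  have : ‖F.eval ζ h‖ ^ 2 = ‖h‖ ^ 2 - ‖T.eval ζ h‖ ^ 2 := by exact_mod_cast e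
  linarith

theorem IsDefectFactor.isIsometric (hF : IsDefectFactor T F) :
    (isomDilation T F).IsIsometric := by
  intro ζ x
  rw [← sq_eq_sq₀ (norm_nonneg _) (norm_nonneg _), WithLp.prod_norm_sq_eq_of_L2,
    WithLp.prod_norm_sq_eq_of_L2, norm_sq_tsum, norm_sq_tsum,
    (summable_sq _).tsum_eq_zero_add, isomDilation_row_Y_zero, isomDilation_row_H]
  simp only [isomDilation_row_Y_succ]
  linarith [hF.norm_sq ζ x.snd]

/-- The range of V(ζ) contains every copy of Y at a position below -1, being the shift of the next
copy, and Q(ζ)u is orthogonal to that range. So the projections of Q(ζ)u to Y₋₁ and H lose nothing.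
-/
theorem IsDefectFactor.pencilQ_apply_succ (hF : IsDefectFactor T F) (ζ : Circle)
    (u : DefectSpace (isomDilation T F)) (n : ℕ) :
    ((pencilQ T F).eval ζ u).fst (n + 1) = 0 := by
  refine ext_inner_left ℂ fun y => ?_
  have h := hF.isIsometric.inner_defectPencil ζ
    (WithLp.toLp 2 (lp.single 2 n y, (0 : H))) u
  have h0 : ((isomDilation T F).eval ζ (WithLp.toLp 2 (lp.single 2 n y, (0 : H)))).ofLp.2 = 0 :=
    (isomDilation_row_H T F ζ _).trans (map_zero _)
  rw [WithLp.prod_inner_apply, h0, inner_zero_left, add_zero] at h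
  rw [inner_zero_right, ← h]
  have e : ((isomDilation T F).eval ζ (WithLp.toLp 2 (lp.single 2 n y, (0 : H)))).fst
      = lp.single 2 (n + 1) y := by
    ext m
    cases m with
    | zero =>
      rw [isomDilation_row_Y_zero]
      simp
    | succ m =>
      rw [isomDilation_row_Y_succ]
      simp [Pi.single_apply]
  have := lp.inner_single_left (𝕜 := ℂ) (G := fun _ : ℕ => Y) (n + 1) y
    ((pencilQ T F).eval ζ u).fst
  rw [← this, ← e]
  rfl

theorem IsDefectFactor.unitaryDilation_fst (hF : IsDefectFactor T F) (ζ : Circle)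
    (k : DilationSpace T F) : ((unitaryDilation T F).eval ζ k).fst =
      (isomDilation T F).eval ζ k.fst + (pencilQ T F).eval ζ (k.snd 0) := by
  have hA : (LinearPencil.mk fun i => projY Y H ∘L (pencilQ T F).coeff i).eval ζ (k.snd 0) =
      ((pencilQ T F).eval ζ (k.snd 0)).fst 0 := by
    change _ = projY Y H ((pencilQ T F).eval ζ (k.snd 0))
    simp [LinearPencil.eval_apply]
  have hB : (LinearPencil.mk fun i => projH Y H ∘L (pencilQ T F).coeff i).eval ζ (k.snd 0) =
      ((pencilQ T F).eval ζ (k.snd 0)).snd := by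
    change _ = projH Y H ((pencilQ T F).eval ζ (k.snd 0))
    simp [LinearPencil.eval_apply]
  refine withLp_prod_ext ?_ ?_
  · ext n
    rw [WithLp.add_fst, lp.coeFn_add, Pi.add_apply]
    cases n with
    | zero =>
      rw [unitaryDilation, blockPencil_row_Y_zero, isomDilation_row_Y_zero, hA]
    | succ n =>
      rw [unitaryDilation, blockPencil_row_Y_succ, isomDilation_row_Y_succ,
        hF.pencilQ_apply_succ, add_zero]
  · rw [WithLp.add_snd, unitaryDilation, blockPencil_row_H, isomDilation_row_H, hB]

theorem unitaryDilation_snd (ζ : ℂ) (k : DilationSpace T F) (n : ℕ) :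
    ((unitaryDilation T F).eval ζ k).snd n = k.snd (n + 1) :=
  blockPencil_row_U _ _ _ _ _ _ _

theorem IsDefectFactor.norm_unitaryDilation (hF : IsDefectFactor T F) (ζ : Circle)
    (k : DilationSpace T F) : ‖(unitaryDilation T F).eval ζ k‖ = ‖k‖ := by
  rw [← sq_eq_sq₀ (norm_nonneg _) (norm_nonneg _), WithLp.prod_norm_sq_eq_of_L2,
    WithLp.prod_norm_sq_eq_of_L2 k, norm_sq_tsum k.snd, norm_sq_tsum,
    (summable_sq k.snd).tsum_eq_zero_add, hF.unitaryDilation_fst]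
  simp only [unitaryDilation_snd]
  have h := norm_add_sq_eq_norm_sq_add_norm_sq_of_inner_eq_zero _ _
    (hF.isIsometric.inner_defectPencil ζ k.fst (k.snd 0))
  rw [hF.isIsometric, hF.isIsometric.norm_defectPencil] at h
  rw [pencilQ, sq ‖_ + _‖, h]
  ring

/-- The range of the isometry V(ζ) is closed, so the K₊ part of `w` splits into some V(ζ)a and a
vector Q(ζ)u. Placing `u` in the first copy of 𝒰 and moving `w.snd` one copy further out gives a
preimage. -/
theorem IsDefectFactor.unitaryDilation_surjective (hF : IsDefectFactor T F) (ζ : Circle) :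
    Function.Surjective ((unitaryDilation T F).eval ζ) := by
  intro w
  let A : KPlus Y H →ₗᵢ[ℂ] KPlus Y H :=
    { toLinearMap := (isomDilation T F).eval ζ, norm_map' := hF.isIsometric ζ }
  have : CompleteSpace ((isomDilation T F).eval ζ).range :=
    (A.isometry.isClosedEmbedding.isClosed_range).completeSpace_coe
  obtain ⟨_, ⟨a, rfl⟩, b, hb, hw⟩ :=
    (((isomDilation T F).eval ζ).range).exists_add_mem_mem_orthogonal w.fst
  obtain ⟨u, hu⟩ := hF.isIsometric.exists_defectPencil ζ
    (w := b) fun x => hb _ (LinearMap.mem_range_self _ x)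
  refine ⟨WithLp.toLp 2 (a, shiftForward _ w.snd + inclZero _ u), withLp_prod_ext ?_ ?_⟩
  · rw [hF.unitaryDilation_fst, hw, ← hu]
    change _ + (pencilQ T F).eval ζ ((shiftForward _ w.snd + inclZero _ u : SeqSum _) 0) = _
    rw [lp.coeFn_add, Pi.add_apply, shiftForward_zero, inclZero_zero, zero_add]
    rfl
  · ext n : 2
    rw [unitaryDilation_snd]
    change (shiftForward _ w.snd + inclZero _ u : SeqSum _) (n + 1) = _
    rw [lp.coeFn_add, Pi.add_apply, shiftForward_succ, inclZero_succ, add_zero]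

theorem mem_unitary_of_norm_map_of_surjective {K : Type*} [NormedAddCommGroup K]
    [InnerProductSpace ℂ K] [CompleteSpace K] {A : K →L[ℂ] K} (h1 : ∀ x, ‖A x‖ = ‖x‖)
    (h2 : Function.Surjective A) : A ∈ unitary (K →L[ℂ] K) := by
  let e : K ≃ₗᵢ[ℂ] K :=
    LinearIsometryEquiv.ofSurjective { toLinearMap := (A : K →ₗ[ℂ] K), norm_map' := h1 } h2
  have : A = (Unitary.linearIsometryEquiv.symm e : unitary (K →L[ℂ] K)) := by
    ext x
    rfl
  rw [this]
  exact SetLike.coe_mem _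

theorem IsDefectFactor.unitaryDilation_isUnitary (hF : IsDefectFactor T F) :
    (unitaryDilation T F).IsUnitary := fun ζ =>
  mem_unitary_of_norm_map_of_surjective (hF.norm_unitaryDilation ζ)
    (hF.unitaryDilation_surjective ζ)

end Factor

/-! ### The triangular block form and the dilation property. -/

section Compression

variable {H : Type u} {Y : Type v} {U : Type w}
  [NormedAddCommGroup H] [InnerProductSpace ℂ H]
  [NormedAddCommGroup Y] [InnerProductSpace ℂ Y]
  [NormedAddCommGroup U] [InnerProductSpace ℂ U]

/-- `A` is block upper triangular in the last two blocks of `K`, with diagonal block `S` on `H`. -/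
def HasDiagonalBlock (A : KFull Y H U →L[ℂ] KFull Y H U) (S : H →L[ℂ] H) : Prop :=
  ∀ k, k.snd = 0 → (A k).snd = 0 ∧ (A k).fst.snd = S k.fst.snd

theorem HasDiagonalBlock.one : HasDiagonalBlock (1 : KFull Y H U →L[ℂ] KFull Y H U) 1 :=
  fun _ hk => ⟨hk, rfl⟩

/-- Vectors without 𝒰-part form an invariant subspace, and on it the Y-entries never feed back into
H. Hence the H-entry is multiplicative, for powers and for words alike. -/
theorem HasDiagonalBlock.mul {A B : KFull Y H U →L[ℂ] KFull Y H U} {S R : H →L[ℂ] H}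
    (hA : HasDiagonalBlock A S) (hB : HasDiagonalBlock B R) :
    HasDiagonalBlock (A * B) (S * R) := fun k hk => by
  obtain ⟨h1, h2⟩ := hB k hk
  obtain ⟨h3, h4⟩ := hA _ h1
  exact ⟨h3, h4.trans (congrArg S h2)⟩

theorem HasDiagonalBlock.pow {A : KFull Y H U →L[ℂ] KFull Y H U} {S : H →L[ℂ] H}
    (hA : HasDiagonalBlock A S) (n : ℕ) : HasDiagonalBlock (A ^ n) (S ^ n) := by
  induction n with
  | zero => exact .one
  | succ n ih => rw [pow_succ, pow_succ]; exact ih.mul hA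

theorem hasDiagonalBlock_coeff (T : LinearPencil H H) (F : LinearPencil H Y)
    (A : LinearPencil U Y) (B : LinearPencil U H) (i : Fin 2) :
    HasDiagonalBlock ((blockPencil T F A B).coeff i) (T.coeff i) := fun k hk => by
  fin_cases i <;> simp [blockPencil, intoSum, compH, compU, hk]

theorem hasDiagonalBlock_eval (T : LinearPencil H H) (F : LinearPencil H Y)
    (A : LinearPencil U Y) (B : LinearPencil U H) (z : ℂ) :
    HasDiagonalBlock ((blockPencil T F A B).eval z) (T.eval z) := fun k hk => by
  refine ⟨?_, ?_⟩
  · ext n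
    rw [blockPencil_row_U, hk]
    rfl
  · rw [blockPencil_row_H, hk]
    simp

variable [CompleteSpace H] [CompleteSpace Y] [CompleteSpace U]

theorem adjoint_embH_apply (k : KFull Y H U) :
    ContinuousLinearMap.adjoint (embH Y H U).toContinuousLinearMap k = k.fst.snd := by
  refine ext_inner_left ℂ fun h => ?_
  rw [ContinuousLinearMap.adjoint_inner_right]
  change ⟪WithLp.toLp 2 (WithLp.toLp 2 ((0 : SeqSum Y), h), (0 : SeqSum U)), k⟫_ℂ = _
  rw [WithLp.prod_inner_apply, WithLp.prod_inner_apply]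
  simp

theorem HasDiagonalBlock.compression {A : KFull Y H U →L[ℂ] KFull Y H U} {S : H →L[ℂ] H}
    (hA : HasDiagonalBlock A S) : S = compression (embH Y H U) A := by
  ext h
  change _ = ContinuousLinearMap.adjoint (embH Y H U).toContinuousLinearMap (A (embH Y H U h))
  rw [adjoint_embH_apply, (hA (embH Y H U h) rfl).2]
  rfl

theorem blockPencil_isUniformDilation (T : LinearPencil H H) (F : LinearPencil H Y)
    (A : LinearPencil U Y) (B : LinearPencil U H) :
    IsUniformDilation (embH Y H U) T (blockPencil T F A B) := by
  refine ⟨fun ζ n => ((hasDiagonalBlock_eval T F A B ζ).pow n).compression, fun j => ?_⟩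
  refine HasDiagonalBlock.compression ?_
  induction j with
  | nil => exact .one
  | cons i j ih => exact (hasDiagonalBlock_coeff T F A B i).mul ih

end Compression

/-! ### Minimality. -/

section Minimal

variable {H : Type u} {Y : Type v} [NormedAddCommGroup H] [InnerProductSpace ℂ H]
  [NormedAddCommGroup Y] [InnerProductSpace ℂ Y]
  {T : LinearPencil H H} {F : LinearPencil H Y}

/-- The inclusion of `⨁ Y` into `K`. -/
noncomputable def inclSeqY (T : LinearPencil H H) (F : LinearPencil H Y) :
    SeqSum Y →L[ℂ] DilationSpace T F :=
  intoSum (intoSum (.id ℂ _) 0) 0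

/-- The inclusion of `⨁ 𝒰` into `K`. -/
noncomputable def inclSeqU (T : LinearPencil H H) (F : LinearPencil H Y) :
    SeqSum (DefectSpace (isomDilation T F)) →L[ℂ] DilationSpace T F :=
  intoSum 0 (.id ℂ _)

theorem inclSeqY_apply (a : SeqSum Y) :
    inclSeqY T F a = WithLp.toLp 2 (WithLp.toLp 2 (a, 0), 0) := rfl

theorem inclSeqU_apply (a : SeqSum (DefectSpace (isomDilation T F))) :
    inclSeqU T F a = WithLp.toLp 2 (0, a) := rfl

theorem embH_apply {U : Type*} [NormedAddCommGroup U] [InnerProductSpace ℂ U] (h : H) :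
    embH Y H U h = WithLp.toLp 2 (WithLp.toLp 2 (0, h), 0) := rfl

variable [CompleteSpace H] [CompleteSpace Y]

/-- A unitary pencil on a subspace `M` which is dilated by a unitary pencil is a restriction, and
`M` is reducing. -/
theorem mem_iff_of_isDilation_subtype {K : Type*} [NormedAddCommGroup K] [InnerProductSpace ℂ K]
    [CompleteSpace K] {U : LinearPencil K K} (hU : U.IsUnitary) (M : Submodule ℂ K)
    [CompleteSpace M] {S : LinearPencil M M} (hS : S.IsUnitary)
    (h : IsDilation M.subtypeₗᵢ S U) (ζ : Circle) (x : K) : U.eval ζ x ∈ M ↔ x ∈ M := by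
  have hSU : ∀ m : M, U.eval ζ m = (S.eval ζ m : K) := by
    intro m
    have e : S.eval ζ m = M.orthogonalProjectionOnto (U.eval ζ m) := by
      have h1 := congrArg (fun A : M →L[ℂ] M => A m) (h ζ 1)
      simp only [pow_one] at h1
      rw [h1]
      change ContinuousLinearMap.adjoint M.subtypeL (U.eval ζ m) = _
      rw [Submodule.adjoint_subtypeL]
    -- Compression to M loses no norm here, as S(ζ) and U(ζ) are both isometric; hence U(ζ)m already
    -- lies in M.
    have hn : ‖M.starProjection (U.eval ζ m)‖ = ‖U.eval ζ m‖ := by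
      rw [ContinuousLinearMap.norm_map_of_mem_unitary (hU ζ), Submodule.starProjection_apply, ← e]
      exact ContinuousLinearMap.norm_map_of_mem_unitary (hS ζ) m
    rw [e, ← Submodule.starProjection_apply]
    exact (Submodule.starProjection_eq_self_iff.2
      ((Submodule.mem_iff_norm_starProjection M _).2 hn)).symm
  constructor
  · intro hx
    -- For the converse, S(ζ) is onto M, so U(ζ)x has a preimage inside M, and injectivity of U(ζ)
    -- identifies it with x.
    have h1 := Unitary.mul_star_self_of_mem (hS ζ)
    have h2 : S.eval ζ (star (S.eval ζ) ⟨_, hx⟩) = ⟨_, hx⟩ :=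
      congrArg (fun A : M →L[ℂ] M => A ⟨_, hx⟩) h1
    have h3 := hSU (star (S.eval ζ) ⟨_, hx⟩)
    rw [h2] at h3
    have h4 : x = star (S.eval ζ) ⟨_, hx⟩ := by
      rw [← sub_eq_zero, ← norm_eq_zero, ← ContinuousLinearMap.norm_map_of_mem_unitary (hU ζ),
        map_sub, h3, sub_self, norm_zero]
    rw [h4]
    exact SetLike.coe_mem _
  · intro hx
    rw [hSU ⟨x, hx⟩]
    exact SetLike.coe_mem _

theorem mem_of_single_mem {X K : Type*} [NormedAddCommGroup X] [InnerProductSpace ℂ X]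
    [NormedAddCommGroup K] [InnerProductSpace ℂ K] (L : SeqSum X →L[ℂ] K) {M : Submodule ℂ K}
    (hM : IsClosed (M : Set K)) (h : ∀ n x, L (lp.single 2 n x) ∈ M) (a : SeqSum X) :
    L a ∈ M := by
  have h1 := (lp.hasSum_single (by norm_num) a).mapL L
  exact hM.mem_of_tendsto h1 (.of_forall fun s => M.sum_mem fun n _ => h n (a n))

theorem unitaryDilation_coeff_zero_embH (h : H) :
    (unitaryDilation T F).coeff 0 (embH Y H _ h) =
      inclSeqY T F (lp.single 2 0 (F.coeff 0 h)) + embH Y H _ (T.coeff 0 h) := by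
  rw [inclSeqY_apply, embH_apply, embH_apply]
  refine withLp_prod_ext (withLp_prod_ext ?_ ?_) ?_ <;>
    simp [unitaryDilation, blockPencil, intoSum, compY, compH, compU, inclZero]

theorem unitaryDilation_inclSeqY (z : ℂ) (n : ℕ) (y : Y) :
    (unitaryDilation T F).eval z (inclSeqY T F (lp.single 2 n y)) =
      inclSeqY T F (lp.single 2 (n + 1) y) := by
  rw [inclSeqY_apply, inclSeqY_apply]
  refine withLp_prod_ext (withLp_prod_ext ?_ ?_) ?_
  · ext m
    cases m with
    | zero =>
      rw [unitaryDilation, blockPencil_row_Y_zero]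
      simp
    | succ m =>
      rw [unitaryDilation, blockPencil_row_Y_succ]
      simp [Pi.single_apply]
  · rw [unitaryDilation, blockPencil_row_H]
    simp
  · ext m : 2
    rw [unitaryDilation_snd]
    simp

theorem IsDefectFactor.unitaryDilation_inclSeqU_zero (hF : IsDefectFactor T F) (ζ : Circle)
    (u : DefectSpace (isomDilation T F)) :
    (unitaryDilation T F).eval ζ (inclSeqU T F (lp.single 2 0 u)) =
      WithLp.toLp 2 ((pencilQ T F).eval ζ u, 0) := by
  rw [inclSeqU_apply]
  refine withLp_prod_ext ?_ ?_
  · rw [hF.unitaryDilation_fst, WithLp.toLp_fst, map_zero, zero_add, WithLp.toLp_snd,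
      lp.single_apply_self]
    rfl
  · ext m : 2
    rw [unitaryDilation_snd, WithLp.toLp_snd, lp.single_apply_ne _ _ _ m.succ_ne_zero]
    rfl

theorem IsDefectFactor.unitaryDilation_inclSeqU_succ (hF : IsDefectFactor T F) (ζ : Circle)
    (n : ℕ) (u : DefectSpace (isomDilation T F)) :
    (unitaryDilation T F).eval ζ (inclSeqU T F (lp.single 2 (n + 1) u)) =
      inclSeqU T F (lp.single 2 n u) := by
  rw [inclSeqU_apply, inclSeqU_apply]
  refine withLp_prod_ext ?_ ?_
  · rw [hF.unitaryDilation_fst, WithLp.toLp_fst, map_zero, zero_add, WithLp.toLp_snd,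
      lp.single_apply_ne _ _ _ n.succ_ne_zero.symm, map_zero]
    rfl
  · ext m : 2
    rw [unitaryDilation_snd, WithLp.toLp_snd, WithLp.toLp_snd]
    rcases eq_or_ne m n with rfl | hmn
    · rw [lp.single_apply_self, lp.single_apply_self]
    · rw [lp.single_apply_ne _ _ _ hmn, lp.single_apply_ne _ _ _ (by simpa using hmn)]

/-- A closed subspace that contains `H` and is reducing for the unitary dilation is everything. -/
theorem IsDefectFactor.eq_top_of_reducing (hF : IsDefectFactor T F)
    (hd : DenseRange (F.coeff 0)) (M : Submodule ℂ (DilationSpace T F))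
    (hc : IsClosed (M : Set (DilationSpace T F))) (hM : ∀ h, embH Y H _ h ∈ M)
    (hU : ∀ (ζ : Circle) x, (unitaryDilation T F).eval ζ x ∈ M ↔ x ∈ M) : M = ⊤ := by
  have hjY : ∀ n y, inclSeqY T F (lp.single 2 n y) ∈ M := by
    intro n
    induction n with
    | zero =>
      have h0 : ∀ h, inclSeqY T F (lp.single 2 0 (F.coeff 0 h)) ∈ M := by
        intro h
        -- U₀h lies in M as the half sum of U(1)h and U(-1)h. It differs from F₀h at position -1 by
        -- T₀h, which lies in H ⊆ M.
        have e : (1 / 2 : ℂ) • ((unitaryDilation T F).eval (1 : Circle) (embH Y H _ h) +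
              (unitaryDilation T F).eval (-1 : Circle) (embH Y H _ h)) =
              (unitaryDilation T F).coeff 0 (embH Y H _ h) := by
          simp only [LinearPencil.eval_apply, Circle.coe_one, Circle.coe_neg]
          module
        rw [unitaryDilation_coeff_zero_embH] at e
        rw [eq_sub_iff_add_eq.2 e.symm]
        exact M.sub_mem (M.smul_mem _ (M.add_mem ((hU _ _).2 (hM h)) ((hU _ _).2 (hM h)))) (hM _)
      intro y
      have hcont : Continuous fun y => inclSeqY T F (inclZero Y y) := by fun_prop
      exact hd.induction_on (p := fun y => inclSeqY T F (inclZero Y y) ∈ M) y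
        (hc.preimage hcont) h0
    | succ n ih =>
      intro y
      rw [← unitaryDilation_inclSeqY (1 : Circle)]
      exact (hU _ _).2 (ih y)
  have hK : ∀ x : KPlus Y H, WithLp.toLp 2 (x, 0) ∈ M := by
    intro x
    have e : WithLp.toLp 2 (x, 0) = inclSeqY T F x.fst + embH Y H _ x.snd := by
      rw [inclSeqY_apply, embH_apply]
      refine withLp_prod_ext (withLp_prod_ext ?_ ?_) ?_
      · exact (add_zero _).symm
      · exact (zero_add _).symm
      · exact (zero_add _).symm
    rw [e]
    exact M.add_mem (mem_of_single_mem (inclSeqY T F) hc hjY _) (hM _)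
  have hjU : ∀ n u, inclSeqU T F (lp.single 2 n u) ∈ M := by
    intro n
    induction n with
    | zero =>
      intro u
      -- The converse direction of `hU` is needed here: U(1) sends the first copy of 𝒰 into K₊,
      -- which is already in M.
      rw [← hU 1, hF.unitaryDilation_inclSeqU_zero]
      exact hK _
    | succ n ih =>
      intro u
      rw [← hU 1, hF.unitaryDilation_inclSeqU_succ]
      exact ih u
  refine (Submodule.eq_top_iff').2 fun x => ?_
  have e : x = WithLp.toLp 2 (x.fst, 0) + inclSeqU T F x.snd := by
    rw [inclSeqU_apply]
    refine withLp_prod_ext ?_ ?_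
    · exact (add_zero _).symm
    · exact (zero_add _).symm
  rw [e]
  exact M.add_mem (hK _) (mem_of_single_mem (inclSeqU T F) hc hjU _)

/-- In `key` the competitor only has to be a unitary pencil dilated by U, so the same argument
settles both notions of minimality. -/
theorem IsDefectFactor.isMinimal (hF : IsDefectFactor T F) (hT : T.IsContractive)
    (hd : DenseRange (F.coeff 0)) :
    IsMinimalUnitaryDilation (embH Y H (DefectSpace (isomDilation T F))) T
        (unitaryDilation T F) ∧
      IsMinimalUniformUnitaryDilation (embH Y H (DefectSpace (isomDilation T F))) T
        (unitaryDilation T F) := by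
  have hu := hF.unitaryDilation_isUnitary
  have hdil : IsUniformDilation (embH Y H _) T (unitaryDilation T F) :=
    blockPencil_isUniformDilation _ _ _ _
  have key : ∀ (M : Submodule ℂ (DilationSpace T F)) [CompleteSpace M]
      (_ : ∀ h, embH Y H _ h ∈ M) (S : LinearPencil M M), S.IsUnitary →
      IsDilation M.subtypeₗᵢ S (unitaryDilation T F) → M = ⊤ := fun M _ hM S hS h =>
    hF.eq_top_of_reducing hd M (completeSpace_coe_iff_isComplete.1 ‹_›).isClosed hM
      (mem_iff_of_isDilation_subtype hu M hS h)
  exact ⟨⟨⟨hT, hu, hdil.1⟩, fun M _ hM S hS h => key M hM S hS.2.1 h⟩,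
    ⟨⟨hT, hu, hdil⟩, fun M _ hM S hS h => key M hM S hS.2.1 h⟩⟩

end Minimal

/-! ### Hardy norms in terms of Taylor coefficients. -/

section Hardy

variable {X : Type u} [NormedAddCommGroup X] [InnerProductSpace ℂ X]

theorem integral_exp_int_mul_I (k : ℤ) :
    ∫ s in (0 : ℝ)..2 * Real.pi, Complex.exp (k * s * Complex.I) =
      if k = 0 then 2 * Real.pi else 0 := by
  split_ifs with h
  · simp [h]
  · have hc : (k * Complex.I : ℂ) ≠ 0 := by simp [h]
    have e : ∀ s : ℝ, Complex.exp (k * s * Complex.I) = Complex.exp (k * Complex.I * s) :=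
      fun s => by ring_nf
    simp only [e]
    rw [integral_exp_mul_complex hc]
    have : Complex.exp (k * Complex.I * (2 * Real.pi : ℝ)) = 1 := by
      rw [Complex.exp_eq_one_iff]
      exact ⟨k, by push_cast; ring⟩
    rw [this]
    simp

/-- Parseval's identity for trigonometric polynomials with vector coefficients. -/
theorem integral_norm_sq_trigPolynomial (N : ℕ) (b : ℕ → X) :
    ∫ s in (0 : ℝ)..2 * Real.pi,
        ‖∑ n ∈ Finset.range N, Complex.exp (s * Complex.I) ^ n • b n‖ ^ 2 =
      2 * Real.pi * ∑ n ∈ Finset.range N, ‖b n‖ ^ 2 := by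
  have h1 : ∀ s : ℝ, ((‖∑ n ∈ Finset.range N, Complex.exp (s * Complex.I) ^ n • b n‖ ^ 2 : ℝ) : ℂ)
      = ∑ n ∈ Finset.range N, ∑ m ∈ Finset.range N,
        Complex.exp (((m - n : ℤ) : ℂ) * s * Complex.I) * ⟪b n, b m⟫_ℂ := by
    intro s
    push_cast
    rw [← Complex.coe_algebraMap, ← inner_self_eq_norm_sq_to_K (𝕜 := ℂ), sum_inner]
    refine Finset.sum_congr rfl fun n _ => ?_
    rw [inner_sum]
    refine Finset.sum_congr rfl fun m _ => ?_
    rw [inner_smul_left, inner_smul_right, ← mul_assoc, map_pow, ← Complex.exp_conj,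
      ← Complex.exp_nat_mul, ← Complex.exp_nat_mul, ← Complex.exp_add]
    congr 2
    simp
    ring
  have h2 : ((∫ s in (0 : ℝ)..2 * Real.pi,
        ‖∑ n ∈ Finset.range N, Complex.exp (s * Complex.I) ^ n • b n‖ ^ 2 : ℝ) : ℂ) =
      ((2 * Real.pi * ∑ n ∈ Finset.range N, ‖b n‖ ^ 2 : ℝ) : ℂ) := by
    rw [← intervalIntegral.integral_ofReal]
    simp only [h1]
    rw [intervalIntegral.integral_finsetSum fun n _ => Continuous.intervalIntegrable
      (by fun_prop) _ _]
    rw [Complex.ofReal_mul, Complex.ofReal_sum, Finset.mul_sum]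
    refine Finset.sum_congr rfl fun n hn => ?_
    rw [intervalIntegral.integral_finsetSum fun n _ => Continuous.intervalIntegrable
      (by fun_prop) _ _]
    simp only [intervalIntegral.integral_mul_const, integral_exp_int_mul_I, sub_eq_zero,
      Nat.cast_inj]
    rw [Finset.sum_eq_single_of_mem n hn fun m _ hm => by rw [if_neg hm]; simp, if_pos rfl,
      inner_self_eq_norm_sq_to_K]
    push_cast
    rfl
  exact_mod_cast h2

theorem lintegral_enorm_sq_trigPolynomial (N : ℕ) (b : ℕ → X) :
    ∫⁻ s in Set.Icc (0 : ℝ) (2 * Real.pi),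
        ‖∑ n ∈ Finset.range N, Complex.exp (s * Complex.I) ^ n • b n‖ₑ ^ 2 =
      ENNReal.ofReal (2 * Real.pi) * ∑ n ∈ Finset.range N, ‖b n‖ₑ ^ 2 := by
  have hc : Continuous fun s : ℝ =>
      ‖∑ n ∈ Finset.range N, Complex.exp (s * Complex.I) ^ n • b n‖ ^ 2 := by fun_prop
  have e : ∀ x : X, ‖x‖ₑ ^ 2 = ENNReal.ofReal (‖x‖ ^ 2) := fun x => by
    rw [ENNReal.ofReal_pow (norm_nonneg _), ofReal_norm]
  simp only [e]
  rw [← ENNReal.ofReal_sum_of_nonneg fun _ _ => by positivity,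
    ← ENNReal.ofReal_mul (by positivity), ← integral_norm_sq_trigPolynomial,
    intervalIntegral.integral_of_le (by positivity),
    ← MeasureTheory.integral_Icc_eq_integral_Ioc,
    MeasureTheory.ofReal_integral_eq_lintegral_ofReal
      (hc.continuousOn.integrableOn_compact isCompact_Icc)
      (Filter.Eventually.of_forall fun _ => by positivity)]

/-- Convergence at a radius q with r < q < 1 bounds qⁿ‖aₙ‖, and (r/q)ⁿ is summable. -/
theorem summable_norm_of_hasSum_ball {x : ℂ → X} {a : ℕ → X}
    (h : ∀ z ∈ Metric.ball (0 : ℂ) 1, HasSum (fun n => z ^ n • a n) (x z)) {r : ℝ}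
    (hr : r ∈ Set.Ioo (0 : ℝ) 1) : Summable fun n => r ^ n * ‖a n‖ := by
  obtain ⟨q, hq1, hq2⟩ := exists_between hr.2
  have hq0 : 0 < q := hr.1.trans hq1
  have hs := (h q (by simpa [abs_of_pos hq0] using hq2)).summable.tendsto_atTop_zero.norm
  obtain ⟨C, hC⟩ := hs.bddAbove_range
  have hC' : ∀ n, q ^ n * ‖a n‖ ≤ C := fun n => by
    have := hC ⟨n, rfl⟩
    simpa [norm_smul, abs_of_pos hq0] using this
  have hg : Summable fun n => C * (r / q) ^ n :=
    (summable_geometric_of_lt_one (div_nonneg hr.1.le hq0.le)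
      ((div_lt_one hq0).2 hq1)).mul_left C
  refine hg.of_nonneg_of_le (fun n => mul_nonneg (pow_nonneg hr.1.le n) (norm_nonneg _))
    fun n => ?_
  calc r ^ n * ‖a n‖ = (q ^ n * ‖a n‖) * (r / q) ^ n := by
        rw [div_pow]; field_simp
    _ ≤ C * (r / q) ^ n := by
        gcongr
        · exact pow_nonneg (div_nonneg hr.1.le hq0.le) n
        · exact hC' n

/-- Parseval for the partial sums, then dominated convergence with the constant bound ∑ rⁿ‖aₙ‖. -/
theorem lintegral_circle_of_hasSum {x : ℂ → X} {a : ℕ → X}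
    (h : ∀ z ∈ Metric.ball (0 : ℂ) 1, HasSum (fun n => z ^ n • a n) (x z)) {r : ℝ}
    (hr : r ∈ Set.Ioo (0 : ℝ) 1) :
    ∫⁻ s in Set.Icc (0 : ℝ) (2 * Real.pi), ‖x (r * Complex.exp (s * Complex.I))‖ₑ ^ 2 =
      ENNReal.ofReal (2 * Real.pi) * ∑' n, ‖((r : ℂ) ^ n) • a n‖ₑ ^ 2 := by
  have hs := summable_norm_of_hasSum_ball h hr
  set C := ∑' n, r ^ n * ‖a n‖
  have hn : ∀ n, 0 ≤ r ^ n * ‖a n‖ := fun n => mul_nonneg (pow_nonneg hr.1.le n) (norm_nonneg _)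
  have h1 : Filter.Tendsto (fun N => ∫⁻ s in Set.Icc (0 : ℝ) (2 * Real.pi),
      ‖∑ n ∈ Finset.range N, Complex.exp (s * Complex.I) ^ n • ((r : ℂ) ^ n) • a n‖ₑ ^ 2)
      Filter.atTop (nhds (∫⁻ s in Set.Icc (0 : ℝ) (2 * Real.pi),
        ‖x (r * Complex.exp (s * Complex.I))‖ₑ ^ 2)) := by
    refine MeasureTheory.tendsto_lintegral_of_dominated_convergence
      (fun _ => ENNReal.ofReal C ^ 2) (fun N => ?_) (fun N => ?_) ?_ ?_
    · refine Continuous.measurable ?_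
      fun_prop
    · refine Filter.Eventually.of_forall fun s => ?_
      simp only
      gcongr
      rw [← ofReal_norm]
      refine ENNReal.ofReal_le_ofReal ((norm_sum_le _ _).trans ?_)
      have e : ∀ n, ‖Complex.exp (s * Complex.I) ^ n • ((r : ℂ) ^ n) • a n‖ = r ^ n * ‖a n‖ := by
        intro n
        simp [norm_smul, Complex.norm_exp_ofReal_mul_I, abs_of_pos hr.1]
      simp only [e]
      exact hs.sum_le_tsum _ fun n _ => hn n
    · simp [ENNReal.mul_ne_top]
    · refine Filter.Eventually.of_forall fun s => ?_
      have hz : (r : ℂ) * Complex.exp (s * Complex.I) ∈ Metric.ball (0 : ℂ) 1 := by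
        simpa [Complex.norm_exp_ofReal_mul_I, abs_of_pos hr.1] using hr.2
      have := (h _ hz).tendsto_sum_nat
      simp only [mul_pow, mul_comm ((r : ℂ) ^ _), mul_smul] at this
      exact (ENNReal.continuous_pow 2).continuousAt.tendsto.comp this.enorm
  simp only [lintegral_enorm_sq_trigPolynomial] at h1
  exact tendsto_nhds_unique h1 (ENNReal.Tendsto.const_mul
    (ENNReal.tendsto_nat_tsum _) (.inr ENNReal.ofReal_ne_top))

/-- The Hardy norm is the `ℓ²` norm of the Taylor coefficients. -/
theorem hardyNorm_sq_of_hasSum {x : ℂ → X} {a : ℕ → X}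
    (h : ∀ z ∈ Metric.ball (0 : ℂ) 1, HasSum (fun n => z ^ n • a n) (x z)) :
    hardyNorm x ^ 2 = ∑' n, ‖a n‖ₑ ^ 2 := by
  have hsup : ⨆ r ∈ Set.Ioo (0 : ℝ) 1, ∑' n, ‖((r : ℂ) ^ n) • a n‖ₑ ^ 2 = ∑' n, ‖a n‖ₑ ^ 2 := by
    refine le_antisymm (iSup₂_le fun r hr => ENNReal.tsum_le_tsum fun n => ?_) ?_
    · gcongr
      rw [enorm_smul]
      refine mul_le_of_le_one_left' ?_
      rw [← ofReal_norm, ← ENNReal.ofReal_one]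
      refine ENNReal.ofReal_le_ofReal ?_
      simpa [abs_of_pos hr.1] using pow_le_one₀ hr.1.le hr.2.le
    -- For the lower bound, each finite partial sum is continuous in r, so letting r → 1⁻ recovers
    -- it.
    · rw [ENNReal.tsum_eq_iSup_sum]
      refine iSup_le fun s => ?_
      have hc : Continuous fun r : ℝ => ∑ n ∈ s, ‖((r : ℂ) ^ n) • a n‖ₑ ^ 2 := by
        refine continuous_finsetSum _ fun n _ => (ENNReal.continuous_pow 2).comp ?_
        fun_prop
      have ht : Filter.Tendsto (fun r : ℝ => ∑ n ∈ s, ‖((r : ℂ) ^ n) • a n‖ₑ ^ 2)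
          (nhdsWithin 1 (Set.Iio 1)) (nhds (∑ n ∈ s, ‖a n‖ₑ ^ 2)) := by
        have := (hc.tendsto 1).mono_left (nhdsWithin_le_nhds (s := Set.Iio 1))
        simpa using this
      refine le_of_tendsto ht ?_
      filter_upwards [Ioo_mem_nhdsLT (zero_lt_one' ℝ)] with r hr
      exact (ENNReal.sum_le_tsum s).trans
        (le_iSup₂ (f := fun (r : ℝ) (_ : r ∈ Set.Ioo (0 : ℝ) 1) =>
          ∑' n, ‖((r : ℂ) ^ n) • a n‖ₑ ^ 2) r hr)
  have hpi : ENNReal.ofReal (2 * Real.pi) ≠ 0 := by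
    simp [Real.pi_pos]
  have h2 : ⨆ r ∈ Set.Ioo (0 : ℝ) 1, ∫⁻ s in Set.Icc (0 : ℝ) (2 * Real.pi),
      ‖x (r * Complex.exp (s * Complex.I))‖ₑ ^ 2 =
      ENNReal.ofReal (2 * Real.pi) * ∑' n, ‖a n‖ₑ ^ 2 := by
    rw [← hsup, ENNReal.mul_iSup]
    refine iSup_congr fun r => ?_
    rw [ENNReal.mul_iSup]
    exact iSup_congr fun hr => lintegral_circle_of_hasSum h hr
  rw [hardyNorm, h2, ← mul_assoc, ENNReal.inv_mul_cancel hpi ENNReal.ofReal_ne_top, one_mul,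
    ← ENNReal.rpow_natCast, ← ENNReal.rpow_mul]
  norm_num

theorem exists_hasSum_of_differentiableOn_ball [CompleteSpace X] {x : ℂ → X}
    (hx : DifferentiableOn ℂ x (Metric.ball 0 1)) :
    ∃ a : ℕ → X, ∀ z ∈ Metric.ball (0 : ℂ) 1, HasSum (fun n => z ^ n • a n) (x z) := by
  refine ⟨fun n => ((n.factorial : ℂ)⁻¹) • iteratedDeriv n x 0, fun z hz => ?_⟩
  have := Complex.hasSum_taylorSeries_on_ball hx hz
  simpa [smul_smul, mul_comm] using this

theorem enorm_apply_zero_le_hardyNorm [CompleteSpace X] {x : ℂ → X}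
    (hx : DifferentiableOn ℂ x (Metric.ball 0 1)) : ‖x 0‖ₑ ≤ hardyNorm x := by
  obtain ⟨a, ha⟩ := exists_hasSum_of_differentiableOn_ball hx
  have h0 : x 0 = a 0 := by
    refine (ha 0 (by simp)).unique ?_
    convert hasSum_single (f := fun n => (0 : ℂ) ^ n • a n) 0 fun n hn => by simp [hn] using 1
    simp
  rw [← ENNReal.pow_le_pow_left_iff two_ne_zero, hardyNorm_sq_of_hasSum ha, h0]
  exact ENNReal.le_tsum (f := fun n => ‖a n‖ₑ ^ 2) 0

variable {Y : Type v} [NormedAddCommGroup Y] [InnerProductSpace ℂ Y]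

theorem LinearPencil.differentiable_eval (F : LinearPencil X Y) : Differentiable ℂ F.eval := by
  unfold LinearPencil.eval
  fun_prop

theorem memHardy_const (y : X) : MemHardy fun _ : ℂ => y := by
  refine ⟨differentiableOn_const y, ?_⟩
  have h : ∀ z ∈ Metric.ball (0 : ℂ) 1,
      HasSum (fun n => z ^ n • (if n = 0 then y else 0)) y := by
    intro z _
    convert hasSum_single (f := fun n => z ^ n • (if n = 0 then y else 0)) 0
      fun n hn => by simp [hn] using 1
    simp
  have h2 := hardyNorm_sq_of_hasSum h
  rw [tsum_eq_single 0 fun n hn => by simp [hn]] at h2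
  refine lt_top_iff_ne_top.2 fun ht => ?_
  rw [ht, if_pos rfl, ENNReal.top_pow two_ne_zero] at h2
  exact ENNReal.pow_ne_top enorm_ne_top h2.symm

/-- The value at `0` of an outer pencil has dense range. -/
theorem IsOuter.denseRange_coeff_zero [CompleteSpace Y] {F : LinearPencil X Y}
    (hF : IsOuter F.eval) : DenseRange (F.coeff 0) := by
  intro y
  rw [EMetric.mem_closure_iff]
  intro ε hε
  -- Approximate the constant function y in H² and evaluate at 0, which is controlled by the Hardy
  -- norm.
  obtain ⟨x, hx, hlt⟩ := hF.2.2 (fun _ => y) (memHardy_const y) ε hε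
  refine ⟨_, ⟨x 0, rfl⟩, lt_of_le_of_lt ?_ hlt⟩
  have hd : DifferentiableOn ℂ (fun z => y - F.eval z (x z)) (Metric.ball 0 1) :=
    (differentiableOn_const y).sub (F.differentiable_eval.differentiableOn.clm_apply hx.1)
  have := enorm_apply_zero_le_hardyNorm hd
  rwa [LinearPencil.eval_apply, zero_smul, add_zero, ← edist_eq_enorm_sub] at this

end Hardy

/-! ### A criterion for outerness. -/

section Outer

variable {X : Type u} {Y : Type v} [NormedAddCommGroup X] [InnerProductSpace ℂ X]
  [NormedAddCommGroup Y] [InnerProductSpace ℂ Y]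

/-- The Taylor coefficients of `F(z) x(z)`, from those of `x`. -/
def LinearPencil.mulCoeff (F : LinearPencil X Y) (x : ℕ → X) : ℕ → Y
  | 0 => F.coeff 0 (x 0)
  | n + 1 => F.coeff 0 (x (n + 1)) + F.coeff 1 (x n)

theorem LinearPencil.hasSum_mulCoeff (F : LinearPencil X Y) {x : ℕ → X} {z : ℂ} {s : X}
    (h : HasSum (fun n => z ^ n • x n) s) :
    HasSum (fun n => z ^ n • F.mulCoeff x n) (F.eval z s) := by
  have h0 : HasSum (fun n => z ^ n • F.coeff 0 (x n)) (F.coeff 0 s) := by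
    simpa using h.mapL (F.coeff 0)
  have h1 : HasSum (fun n => z ^ (n + 1) • F.coeff 1 (x n)) (z • F.coeff 1 s) := by
    simpa [pow_succ', mul_smul] using (h.mapL (F.coeff 1)).const_smul z
  rw [← hasSum_nat_add_iff' 1] at h0 ⊢
  rw [LinearPencil.eval_apply]
  convert h0.add h1 using 1
  · ext n
    simp [LinearPencil.mulCoeff]
  · simp [LinearPencil.mulCoeff]
    abel

theorem enorm_sq_eq_ofReal {Y : Type*} [NormedAddCommGroup Y] (y : Y) :
    ‖y‖ₑ ^ 2 = ENNReal.ofReal (‖y‖ ^ 2) := by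
  rw [ENNReal.ofReal_pow (norm_nonneg _), ofReal_norm]

theorem enorm_sub_sq_le {Y : Type*} [NormedAddCommGroup Y] (a b c : Y) :
    ‖a - c‖ₑ ^ 2 ≤ 2 * ‖a - b‖ₑ ^ 2 + 2 * ‖b - c‖ₑ ^ 2 := by
  have h4 : ‖a - c‖ ^ 2 ≤ 2 * ‖a - b‖ ^ 2 + 2 * ‖b - c‖ ^ 2 := by
    have h5 := norm_sub_le_norm_sub_add_norm_sub a b c
    nlinarith [sq_nonneg (‖a - b‖ - ‖b - c‖), norm_nonneg (a - c)]
  have e2 : (2 : ℝ≥0∞) = ENNReal.ofReal 2 := by simp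
  rw [enorm_sq_eq_ofReal, enorm_sq_eq_ofReal, enorm_sq_eq_ofReal, e2,
    ← ENNReal.ofReal_mul (by norm_num), ← ENNReal.ofReal_mul (by norm_num),
    ← ENNReal.ofReal_add (by positivity) (by positivity)]
  exact ENNReal.ofReal_le_ofReal h4

/-- A linear pencil whose multiplication operator has dense range on polynomials is outer. -/
theorem isOuter_of_approx [CompleteSpace Y] {F : LinearPencil X Y}
    (hc : ∀ z ∈ Metric.ball (0 : ℂ) 1, ‖F.eval z‖ ≤ 1)
    (hF : ∀ (N : ℕ) (b : ℕ → Y), (∀ k, N ≤ k → b k = 0) → ∀ ε : ℝ, 0 < ε →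
      ∃ (x : ℕ →₀ X) (R : ℕ), (∀ k, R ≤ k → b k - F.mulCoeff x k = 0) ∧
        ∑ k ∈ Finset.range R, ‖b k - F.mulCoeff x k‖ ^ 2 < ε) :
    IsOuter F.eval := by
  refine ⟨F.differentiable_eval.differentiableOn, hc, fun y hy ε hε => ?_⟩
  obtain ⟨a, ha⟩ := exists_hasSum_of_differentiableOn_ball hy.1
  have hsum : ∑' n, ‖a n‖ₑ ^ 2 ≠ ∞ := by
    rw [← hardyNorm_sq_of_hasSum ha]
    exact ENNReal.pow_ne_top hy.2.ne
  -- The final estimate is 2(ε²/4 + ε²/4) = ε²: one share for truncating the Taylor series of `y`,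
  -- one for approximating the resulting polynomial `b`.
  have hε' : 0 < ε ^ 2 / 4 := ENNReal.div_pos (by simpa using hε.ne') (by norm_num)
  obtain ⟨N, hN⟩ := ((ENNReal.tendsto_sum_nat_add _ hsum).eventually_lt_const hε').exists
  obtain ⟨η, hη0, hη⟩ := ENNReal.lt_iff_exists_nnreal_btwn.1 hε'
  set b : ℕ → Y := fun k => if k < N then a k else 0 with hb
  obtain ⟨x, R, hR, hlt⟩ := hF N b (fun k hk => by simp [hb, not_lt.2 hk]) η
    (by exact_mod_cast hη0)
  have hx : ∀ z : ℂ, HasSum (fun n => z ^ n • x n) (∑ n ∈ x.support, z ^ n • x n) := fun z =>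
    hasSum_sum_of_ne_finset_zero fun n hn => by simp [Finsupp.notMem_support_iff.1 hn]
  refine ⟨fun z => ∑ n ∈ x.support, z ^ n • x n, ⟨?_, ?_⟩, ?_⟩
  · refine Differentiable.differentiableOn ?_
    fun_prop
  · have h2 := hardyNorm_sq_of_hasSum fun z (_ : z ∈ Metric.ball (0 : ℂ) 1) => hx z
    rw [tsum_eq_sum (s := x.support) fun n hn => by
      simp [Finsupp.notMem_support_iff.1 hn]] at h2
    have h3 : ∑ n ∈ x.support, ‖x n‖ₑ ^ 2 < ∞ :=
      ENNReal.sum_lt_top.2 fun n _ => ENNReal.pow_lt_top enorm_lt_top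
    rw [← h2] at h3
    exact lt_of_not_ge fun h => by
      rw [top_le_iff.1 h] at h3
      simp at h3
  · rw [← ENNReal.pow_lt_pow_left_iff two_ne_zero,
      hardyNorm_sq_of_hasSum (a := fun n => a n - F.mulCoeff x n) fun z hz => by
        simpa only [smul_sub] using (ha z hz).sub (F.hasSum_mulCoeff (hx z))]
    have h1 : ∑' k, ‖a k - b k‖ₑ ^ 2 < ε ^ 2 / 4 := by
      refine lt_of_eq_of_lt ?_ hN
      rw [← Summable.sum_add_tsum_nat_add' (k := N) ENNReal.summable, Finset.sum_eq_zero, zero_add]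
      · simp [hb]
      · intro k hk
        simp [hb, Finset.mem_range.1 hk]
    have h2 : ∑' k, ‖b k - F.mulCoeff x k‖ₑ ^ 2 < ε ^ 2 / 4 := by
      rw [tsum_eq_sum (s := Finset.range R) fun k hk => by
        rw [hR k (by simpa using hk)]; simp]
      refine lt_of_le_of_lt ?_ hη
      simp only [enorm_sq_eq_ofReal]
      rw [← ENNReal.ofReal_sum_of_nonneg fun _ _ => by positivity]
      rw [← ENNReal.ofReal_coe_nnreal]
      exact ENNReal.ofReal_le_ofReal hlt.le
    have h3 := fun k => enorm_sub_sq_le (a k) (b k) (F.mulCoeff x k)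
    calc ∑' k, ‖a k - F.mulCoeff x k‖ₑ ^ 2
        ≤ ∑' k, (2 * ‖a k - b k‖ₑ ^ 2 + 2 * ‖b k - F.mulCoeff x k‖ₑ ^ 2) :=
          ENNReal.tsum_le_tsum h3
      _ = 2 * (∑' k, ‖a k - b k‖ₑ ^ 2 + ∑' k, ‖b k - F.mulCoeff x k‖ₑ ^ 2) := by
          rw [ENNReal.tsum_add, ENNReal.tsum_mul_left, ENNReal.tsum_mul_left, mul_add]
      _ < 2 * (ε ^ 2 / 4 + ε ^ 2 / 4) := by
          exact (ENNReal.mul_lt_mul_iff_right two_ne_zero ENNReal.ofNat_ne_top).2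
            (ENNReal.add_lt_add h1 h2)
      _ = ε ^ 2 := by
          rw [← two_mul, ← mul_assoc, show (2 * 2 : ℝ≥0∞) = 4 by norm_num]
          exact ENNReal.mul_div_cancel (by norm_num) (by norm_num)

/-- A pencil is affine in z, and every point of the closed disk is a convex combination of the ends
of a diameter. -/
theorem LinearPencil.norm_eval_le_one_of_circle {F : LinearPencil X Y}
    (hF : ∀ (ζ : Circle), ‖F.eval ζ‖ ≤ 1) {z : ℂ} (hz : ‖z‖ ≤ 1) : ‖F.eval z‖ ≤ 1 := by
  have e : F.eval z = ((1 + ‖z‖) / 2 : ℝ) • F.eval (Circle.exp z.arg) +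
      ((1 - ‖z‖) / 2 : ℝ) • F.eval (-Circle.exp z.arg : Circle) := by
    ext x
    have h : z = ‖z‖ * (Circle.exp z.arg : ℂ) := by
      rw [Circle.coe_exp, Complex.norm_mul_exp_arg_mul_I]
    simp only [add_apply, smul_apply, LinearPencil.eval_apply]
    rw [Circle.coe_neg]
    conv_lhs => rw [h]
    simp only [← Complex.coe_smul]
    push_cast
    module
  rw [e]
  refine (norm_add_le _ _).trans ?_
  rw [norm_smul, norm_smul, Real.norm_of_nonneg (by positivity),
    Real.norm_of_nonneg (by linarith)]
  have h1 := hF (Circle.exp z.arg)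
  have h2 := hF (-Circle.exp z.arg)
  nlinarith [norm_nonneg z]

end Outer

/-! ### The Wold decomposition and the pencil it produces. -/

theorem linearIsometryEquiv_mul_apply {N : Type*} [NormedAddCommGroup N] [NormedSpace ℂ N]
    (R S : N ≃ₗᵢ[ℂ] N) (x : N) : (R * S) x = R (S x) := rfl

section Wold

variable {N : Type u} {H : Type v} [NormedAddCommGroup N] [InnerProductSpace ℂ N]
  [NormedAddCommGroup H] [InnerProductSpace ℂ H]
  (S : N ≃ₗᵢ[ℂ] N) (δ : H →L[ℂ] N)

/-- The closed span of `S ^ j (δ H)`, `j ≥ k`. -/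
def tailSpan (k : ℕ) : Submodule ℂ N :=
  (Submodule.span ℂ {x | ∃ j, k ≤ j ∧ ∃ h, (S ^ j) (δ h) = x}).topologicalClosure

theorem isClosed_tailSpan (k : ℕ) : IsClosed (tailSpan S δ k : Set N) :=
  Submodule.isClosed_topologicalClosure _

variable {S δ}

theorem mem_tailSpan {k j : ℕ} (hkj : k ≤ j) (h : H) : (S ^ j) (δ h) ∈ tailSpan S δ k :=
  Submodule.le_topologicalClosure _ (Submodule.subset_span ⟨j, hkj, h, rfl⟩)

theorem tailSpan_le {k : ℕ} {M : Submodule ℂ N} (hM : IsClosed (M : Set N))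
    (h : ∀ j, k ≤ j → ∀ h, (S ^ j) (δ h) ∈ M) : tailSpan S δ k ≤ M := by
  refine Submodule.topologicalClosure_minimal _ (Submodule.span_le.2 ?_) hM
  rintro _ ⟨j, hj, x, rfl⟩
  exact h j hj x

theorem tailSpan_antitone : Antitone (tailSpan S δ) := fun _ _ hkl =>
  tailSpan_le (isClosed_tailSpan S δ _) fun _ hj x => mem_tailSpan (hkl.trans hj) x

theorem map_mem_tailSpan {k : ℕ} {x : N} (hx : x ∈ tailSpan S δ k) :
    S x ∈ tailSpan S δ (k + 1) := by
  have : tailSpan S δ k ≤ (tailSpan S δ (k + 1)).comap (S : N →ₗ[ℂ] N) := by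
    refine tailSpan_le ((isClosed_tailSpan S δ _).preimage S.continuous) fun j hj h => ?_
    change S ((S ^ j) (δ h)) ∈ tailSpan S δ (k + 1)
    rw [← linearIsometryEquiv_mul_apply, ← pow_succ']
    exact mem_tailSpan (by omega) h
  exact this hx

theorem pow_map_mem_tailSpan {k : ℕ} {x : N} (hx : x ∈ tailSpan S δ 0) :
    (S ^ k) x ∈ tailSpan S δ k := by
  induction k with
  | zero => exact hx
  | succ k ih =>
    rw [pow_succ']
    exact map_mem_tailSpan ih

theorem symm_map_mem_tailSpan {k : ℕ} {x : N} (hx : x ∈ tailSpan S δ (k + 1)) :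
    S.symm x ∈ tailSpan S δ k := by
  have : tailSpan S δ (k + 1) ≤ (tailSpan S δ k).comap (S.symm : N →ₗ[ℂ] N) := by
    refine tailSpan_le ((isClosed_tailSpan S δ _).preimage S.symm.continuous) fun j hj h => ?_
    change S.symm ((S ^ j) (δ h)) ∈ tailSpan S δ k
    obtain ⟨i, rfl⟩ : ∃ i, j = i + 1 := ⟨j - 1, by omega⟩
    rw [pow_succ', linearIsometryEquiv_mul_apply, LinearIsometryEquiv.symm_apply_apply]
    exact mem_tailSpan (by omega) h
  exact this hx

variable (S δ) in
/-- The wandering subspace of `S` on the closed span of `S ^ j (δ H)`, `j ≥ 0`. -/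
noncomputable def wanderingSpace : Submodule ℂ N := tailSpan S δ 0 ⊓ (tailSpan S δ 1)ᗮ

theorem inner_pow_wanderingSpace {x y : N} (hx : x ∈ wanderingSpace S δ)
    (hy : y ∈ wanderingSpace S δ) {k : ℕ} (hk : 1 ≤ k) : ⟪x, (S ^ k) y⟫_ℂ = 0 :=
  Submodule.inner_left_of_mem_orthogonal (tailSpan_antitone hk (pow_map_mem_tailSpan hy.1)) hx.2

/-- Induction by splitting off the zeroth term: the others lie in `tailSpan S δ 1`, orthogonal to
the wandering space, and their sum is `S` applied to a shorter sum of the same kind. -/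
theorem norm_sq_sum_pow_wanderingSpace (n : ℕ) (y : ℕ → wanderingSpace S δ) :
    ‖∑ k ∈ Finset.range n, (S ^ k) (y k : N)‖ ^ 2 = ∑ k ∈ Finset.range n, ‖y k‖ ^ 2 := by
  induction n generalizing y with
  | zero => simp
  | succ n ih =>
    have h1 : ∑ k ∈ Finset.range n, (S ^ (k + 1)) (y (k + 1) : N) =
        S (∑ k ∈ Finset.range n, (S ^ k) (y (k + 1) : N)) := by
      rw [map_sum]
      simp only [pow_succ']
      rfl
    have h2 : ∑ k ∈ Finset.range n, (S ^ (k + 1)) (y (k + 1) : N) ∈ tailSpan S δ 1 :=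
      Submodule.sum_mem _ fun k _ =>
        tailSpan_antitone (by omega) (pow_map_mem_tailSpan (y (k + 1)).2.1)
    have h3 : ⟪∑ k ∈ Finset.range n, (S ^ (k + 1)) (y (k + 1) : N), (S ^ 0) (y 0 : N)⟫_ℂ = 0 :=
      Submodule.inner_right_of_mem_orthogonal h2 (y 0).2.2
    rw [Finset.sum_range_succ', Finset.sum_range_succ', sq,
      norm_add_sq_eq_norm_sq_add_norm_sq_of_inner_eq_zero _ _ h3, h1, S.norm_map, ← sq, ← sq,
      ih fun k => y (k + 1)]
    rfl

/-- The vanishing of the correlations from index 2 on is what limits the factor to degree one. -/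
theorem inner_tailSpan_two (hb : ∀ k, 2 ≤ k → ∀ h h', ⟪δ h, (S ^ k) (δ h')⟫_ℂ = 0)
    {x : N} (hx : x ∈ tailSpan S δ 2) (h : H) : ⟪x, δ h⟫_ℂ = 0 := by
  have : tailSpan S δ 2 ≤ (Submodule.span ℂ {δ h})ᗮ :=
    tailSpan_le (Submodule.isClosed_orthogonal _) fun j hj h' =>
      Submodule.mem_orthogonal_singleton_iff_inner_right.2 (hb j hj h h')
  exact Submodule.mem_orthogonal_singleton_iff_inner_left.1 (this hx)

theorem exists_finsupp_near_of_mem_tailSpan {w : N} (hw : w ∈ tailSpan S δ 0) {ε : ℝ}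
    (hε : 0 < ε) : ∃ (x : ℕ →₀ H) (n : ℕ), (∀ k, n ≤ k → x k = 0) ∧
      ‖w - ∑ k ∈ Finset.range n, (S ^ k) (δ (x k))‖ < ε := by
  let A : (ℕ →₀ H) →ₗ[ℂ] N :=
    Finsupp.lsum ℂ fun k => ((S ^ k : N ≃ₗᵢ[ℂ] N) : N →ₗ[ℂ] N) ∘ₗ (δ : H →ₗ[ℂ] N)
  have h1 : tailSpan S δ 0 ≤ A.range.topologicalClosure := by
    refine tailSpan_le (Submodule.isClosed_topologicalClosure _) fun j _ h =>
      Submodule.le_topologicalClosure _ ⟨Finsupp.single j h, ?_⟩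
    simp [A]
  obtain ⟨_, ⟨x, rfl⟩, hx⟩ := Metric.mem_closure_iff.1 (h1 hw) ε hε
  refine ⟨x, x.support.sup id + 1, fun k hk => ?_, ?_⟩
  · by_contra hne
    have := Finset.le_sup (f := id) (Finsupp.mem_support_iff.2 hne)
    simp only [id] at this
    omega
  · have hA : A x = ∑ k ∈ Finset.range (x.support.sup id + 1), (S ^ k) (δ (x k)) := by
      refine Finset.sum_subset (fun k hk => ?_) fun k _ hk => ?_
      · have := Finset.le_sup (f := id) hk
        simp only [id] at this
        exact Finset.mem_range.2 (by omega)
      · simp [Finsupp.notMem_support_iff.1 hk]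
    rwa [dist_eq_norm, hA] at hx

variable [CompleteSpace N]

instance instCompleteSpaceTailSpan (k : ℕ) : CompleteSpace (tailSpan S δ k) :=
  (isClosed_tailSpan S δ k).completeSpace_coe

instance instCompleteSpaceWanderingSpace : CompleteSpace (wanderingSpace S δ) :=
  ((isClosed_tailSpan S δ 0).inter (Submodule.isClosed_orthogonal _)).completeSpace_coe

theorem wold_mem_zero (h : H) :
    δ h - (tailSpan S δ 1).starProjection (δ h) ∈ wanderingSpace S δ :=
  ⟨Submodule.sub_mem _ (mem_tailSpan (j := 0) le_rfl h)
    (tailSpan_antitone zero_le_one (Submodule.starProjection_apply_mem _ _)),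
    Submodule.sub_starProjection_mem_orthogonal _⟩

/-- Let p be the projection of δh to `tailSpan S δ 1`. For x in that space, Sx lies in `tailSpan S δ
2` and is orthogonal to δh and to δh - p, hence to p; so S⁻¹p is orthogonal to x. -/
theorem wold_mem_one (hb : ∀ k, 2 ≤ k → ∀ h h', ⟪δ h, (S ^ k) (δ h')⟫_ℂ = 0) (h : H) :
    S.symm ((tailSpan S δ 1).starProjection (δ h)) ∈ wanderingSpace S δ := by
  refine ⟨symm_map_mem_tailSpan (Submodule.starProjection_apply_mem _ _), fun x hx => ?_⟩
  have h1 : ⟪S x, δ h⟫_ℂ = 0 := inner_tailSpan_two hb (map_mem_tailSpan hx) h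
  have h2 : ⟪S x, δ h - (tailSpan S δ 1).starProjection (δ h)⟫_ℂ = 0 :=
    (wold_mem_zero h).2 _ (tailSpan_antitone one_le_two (map_mem_tailSpan hx))
  rw [inner_sub_right, h1, zero_sub, neg_eq_zero] at h2
  rw [← S.inner_map_map, S.apply_symm_apply, h2]

/-- The pencil with values in the wandering space given by the Wold decomposition of `δ`. -/
noncomputable def woldPencil (hb : ∀ k, 2 ≤ k → ∀ h h', ⟪δ h, (S ^ k) (δ h')⟫_ℂ = 0) :
    LinearPencil H (wanderingSpace S δ) where
  coeff := ![
    (δ - (tailSpan S δ 1).starProjection ∘L δ).codRestrict _ wold_mem_zero,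
    ((S.symm : N →L[ℂ] N) ∘L (tailSpan S δ 1).starProjection ∘L δ).codRestrict _
      (wold_mem_one hb)]

variable (hb : ∀ k, 2 ≤ k → ∀ h h', ⟪δ h, (S ^ k) (δ h')⟫_ℂ = 0)

theorem woldPencil_add (h : H) :
    ((woldPencil hb).coeff 0 h : N) + S ((woldPencil hb).coeff 1 h : N) = δ h := by
  change δ h - (tailSpan S δ 1).starProjection (δ h) +
    S (S.symm ((tailSpan S δ 1).starProjection (δ h))) = δ h
  simp

theorem woldPencil_inner (h h' : H) :
    ⟪(woldPencil hb).coeff 0 h, (woldPencil hb).coeff 0 h'⟫_ℂ +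
      ⟪(woldPencil hb).coeff 1 h, (woldPencil hb).coeff 1 h'⟫_ℂ = ⟪δ h, δ h'⟫_ℂ := by
  rw [← woldPencil_add hb h, ← woldPencil_add hb h', inner_add_left, inner_add_right,
    inner_add_right, S.inner_map_map]
  have h1 := inner_pow_wanderingSpace ((woldPencil hb).coeff 0 h).2
    ((woldPencil hb).coeff 1 h').2 le_rfl
  have h2 := inner_pow_wanderingSpace ((woldPencil hb).coeff 0 h').2
    ((woldPencil hb).coeff 1 h).2 le_rfl
  rw [pow_one] at h1 h2
  rw [← inner_conj_symm (S _), h1, h2, map_zero, add_zero, zero_add]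
  rfl

/-- Writing δ = F₀ + S F₁ on both sides gives four terms; three pair a wandering vector with a
positive power of `S` applied to another, and vanish. -/
theorem woldPencil_inner_one_zero (h h' : H) :
    ⟪(woldPencil hb).coeff 1 h, (woldPencil hb).coeff 0 h'⟫_ℂ = ⟪δ h, S (δ h')⟫_ℂ := by
  rw [← woldPencil_add hb h, ← woldPencil_add hb h', map_add, inner_add_left, inner_add_right,
    inner_add_right, S.inner_map_map, S.inner_map_map]
  have h1 := inner_pow_wanderingSpace ((woldPencil hb).coeff 0 h).2
    ((woldPencil hb).coeff 0 h').2 le_rfl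
  have h2 := inner_pow_wanderingSpace ((woldPencil hb).coeff 0 h).2
    ((woldPencil hb).coeff 1 h').2 one_le_two
  have h3 := inner_pow_wanderingSpace ((woldPencil hb).coeff 1 h).2
    ((woldPencil hb).coeff 1 h').2 le_rfl
  rw [pow_one] at h1 h3
  rw [pow_two, linearIsometryEquiv_mul_apply] at h2
  rw [h1, h2, h3, add_zero, zero_add, add_zero]
  rfl

/-- Under the correspondence ∑ zᵏ yₖ ↦ ∑ Sᵏ yₖ, the product F·x becomes ∑ Sᵏ δxₖ. The product has
one more coefficient than x, and `x n = 0` removes the boundary term. -/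
theorem sum_pow_woldPencil (x : ℕ → H) (n : ℕ) (hx : ∀ k, n ≤ k → x k = 0) :
    ∑ k ∈ Finset.range (n + 1), (S ^ k) ((woldPencil hb).mulCoeff x k : N) =
      ∑ k ∈ Finset.range n, (S ^ k) (δ (x k)) := by
  rw [Finset.sum_range_succ']
  simp only [LinearPencil.mulCoeff, Submodule.coe_add, map_add, Finset.sum_add_distrib]
  have h1 := Finset.sum_range_succ' (fun k => (S ^ k) ((woldPencil hb).coeff 0 (x k) : N)) n
  rw [Finset.sum_range_succ, hx n le_rfl, map_zero, Submodule.coe_zero, map_zero, add_zero] at h1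
  rw [add_right_comm, ← h1, ← Finset.sum_add_distrib]
  refine Finset.sum_congr rfl fun k _ => ?_
  rw [← woldPencil_add hb (x k), map_add, pow_succ, linearIsometryEquiv_mul_apply]

/-- The polynomial `b` corresponds to a vector of `tailSpan S δ 0`, which finite sums ∑ Sᵏ δxₖ
approximate by definition. Orthogonality of the Sᵏ W turns the norm of the error into the required
sum of squares. -/
theorem woldPencil_approx (n : ℕ) (b : ℕ → wanderingSpace S δ) (hn : ∀ k, n ≤ k → b k = 0)
    (ε : ℝ) (hε : 0 < ε) :
    ∃ (x : ℕ →₀ H) (R : ℕ), (∀ k, R ≤ k → b k - (woldPencil hb).mulCoeff x k = 0) ∧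
      ∑ k ∈ Finset.range R, ‖b k - (woldPencil hb).mulCoeff x k‖ ^ 2 < ε := by
  have hw : ∑ k ∈ Finset.range n, (S ^ k) (b k : N) ∈ tailSpan S δ 0 :=
    Submodule.sum_mem _ fun k _ => tailSpan_antitone k.zero_le (pow_map_mem_tailSpan (b k).2.1)
  obtain ⟨x, m, hm, hlt⟩ := exists_finsupp_near_of_mem_tailSpan hw (Real.sqrt_pos.2 hε)
  set R := max n (m + 1) with hR
  have hmul : ∀ k, m + 1 ≤ k → (woldPencil hb).mulCoeff x k = 0 := by
    intro k hk
    obtain ⟨k, rfl⟩ : ∃ i, k = i + 1 := ⟨k - 1, by omega⟩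
    simp [LinearPencil.mulCoeff, hm k (by omega), hm (k + 1) (by omega)]
  refine ⟨x, R, fun k hk => ?_, ?_⟩
  · rw [hn k (by omega), hmul k (by omega), sub_zero]
  · have e1 : ∑ k ∈ Finset.range R, (S ^ k) (b k : N) =
        ∑ k ∈ Finset.range n, (S ^ k) (b k : N) := by
      refine (Finset.sum_subset (Finset.range_mono (by omega)) fun k _ hk => ?_).symm
      rw [hn k (by simpa using hk)]
      simp
    have e2 : ∑ k ∈ Finset.range R, (S ^ k) ((woldPencil hb).mulCoeff x k : N) =
        ∑ k ∈ Finset.range m, (S ^ k) (δ (x k)) := by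
      rw [← sum_pow_woldPencil hb x m hm]
      refine (Finset.sum_subset (Finset.range_mono (by omega)) fun k _ hk => ?_).symm
      rw [hmul k (by simpa using hk)]
      simp
    rw [← norm_sq_sum_pow_wanderingSpace]
    simp only [Submodule.coe_sub, map_sub, Finset.sum_sub_distrib]
    rw [e1, e2]
    exact (Real.lt_sqrt (norm_nonneg _)).1 hlt

end Wold

/-! ### The defect operator and its correlations. -/

section DefectOperator

variable {N : Type u} [NormedAddCommGroup N] [InnerProductSpace ℂ N] [CompleteSpace N]

/-- The defect operator of a contraction commutes with the unitary operators commuting with the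
contraction. -/
theorem exists_defectOperator (S : N ≃ₗᵢ[ℂ] N) (M : N →L[ℂ] N) (hM : ‖M‖ ≤ 1)
    (hS : ∀ x, M (S x) = S (M x)) :
    ∃ Δ : N →L[ℂ] N, (∀ x, Δ (S x) = S (Δ x)) ∧
      ∀ x y, ⟪Δ x, Δ y⟫_ℂ = ⟪x, y⟫_ℂ - ⟪M x, M y⟫_ℂ := by
  have hM' : ∀ x, M (S.symm x) = S.symm (M x) := fun x => by
    rw [← S.symm_apply_apply (M (S.symm x)), ← hS, S.apply_symm_apply]
  have hinner : ∀ x y, ⟪x, (1 - star M * M) y⟫_ℂ = ⟪x, y⟫_ℂ - ⟪M x, M y⟫_ℂ := fun x y => by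
    change ⟪x, y - ContinuousLinearMap.adjoint M (M y)⟫_ℂ = _
    rw [inner_sub_right, ContinuousLinearMap.adjoint_inner_right]
  have hpos : 0 ≤ 1 - star M * M := by
    rw [ContinuousLinearMap.nonneg_iff_isPositive, ContinuousLinearMap.isPositive_iff']
    refine ⟨(IsSelfAdjoint.one _).sub (IsSelfAdjoint.star_mul_self M), fun x => ?_⟩
    have h1 : ‖M x‖ ≤ ‖x‖ := M.le_of_opNorm_le hM x |>.trans_eq (one_mul _)
    rw [← inner_conj_symm, hinner, inner_self_eq_norm_sq_to_K, inner_self_eq_norm_sq_to_K]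
    have h2 : (0 : ℝ) ≤ ‖x‖ ^ 2 - ‖M x‖ ^ 2 := by nlinarith [norm_nonneg (M x)]
    have h3 : starRingEnd ℂ ((‖x‖ : ℂ) ^ 2 - (‖M x‖ : ℂ) ^ 2) =
      ((‖x‖ ^ 2 - ‖M x‖ ^ 2 : ℝ) : ℂ) := by simp
    exact h3.symm ▸ (by exact_mod_cast h2)
  have hadj : ∀ x, star M (S x) = S (star M x) := fun x => by
    refine ext_inner_right ℂ fun y => ?_
    change ⟪ContinuousLinearMap.adjoint M (S x), y⟫_ℂ = ⟪S (ContinuousLinearMap.adjoint M x), y⟫_ℂ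
    rw [ContinuousLinearMap.adjoint_inner_left, ← S.symm.inner_map_map (S _) y,
      S.symm_apply_apply, ContinuousLinearMap.adjoint_inner_left, hM', ← S.inner_map_map x,
      S.apply_symm_apply]
  have hcomm : Commute (1 - star M * M) (S : N →L[ℂ] N) := by
    ext x
    change S x - star M (M (S x)) = S (x - star M (M x))
    rw [hS, hadj, map_sub]
  -- `S` commutes with M and, being unitary, with M*; the continuous functional calculus passes this
  -- on to the square root.
  refine ⟨CFC.sqrt (1 - star M * M), fun x => ?_, fun x y => ?_⟩
  · have h : Commute (CFC.sqrt (1 - star M * M)) (S : N →L[ℂ] N) := hcomm.cfcₙ_nnreal _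
    exact congrArg (fun A : N →L[ℂ] N => A x) h.eq
  · have h1 : IsSelfAdjoint (CFC.sqrt (1 - star M * M)) :=
      IsSelfAdjoint.of_nonneg (CFC.sqrt_nonneg _)
    have h2 := CFC.sqrt_mul_sqrt_self (1 - star M * M) hpos
    rw [← ContinuousLinearMap.adjoint_inner_right, ← hinner]
    nth_rw 3 [← h2]
    rw [← ContinuousLinearMap.star_eq_adjoint, h1.star_eq]
    rfl

end DefectOperator

section DefectCorrelations

variable {N : Type u} [NormedAddCommGroup N] [InnerProductSpace ℂ N]
  {H : Type v} [NormedAddCommGroup H] [InnerProductSpace ℂ H]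

/-- The correlations of the defect operator restricted to a wandering copy of `H`. -/
theorem inner_pow_defect (T : LinearPencil H H) {S : N ≃ₗᵢ[ℂ] N} {M Δ : N →L[ℂ] N}
    {e : H →L[ℂ] N} (hM : ∀ x, M (S x) = S (M x)) (hΔS : ∀ x, Δ (S x) = S (Δ x))
    (hΔ : ∀ x y, ⟪Δ x, Δ y⟫_ℂ = ⟪x, y⟫_ℂ - ⟪M x, M y⟫_ℂ)
    (hMe : ∀ h, M (e h) = e (T.coeff 0 h) + S (e (T.coeff 1 h))) (k : ℕ) (h h' : H) :
    ⟪Δ (e h), (S ^ k) (Δ (e h'))⟫_ℂ = ⟪e h, (S ^ k) (e h')⟫_ℂ -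
      (⟪e (T.coeff 0 h), (S ^ k) (e (T.coeff 0 h'))⟫_ℂ +
        ⟪e (T.coeff 0 h), (S ^ (k + 1)) (e (T.coeff 1 h'))⟫_ℂ +
        ⟪S (e (T.coeff 1 h)), (S ^ k) (e (T.coeff 0 h'))⟫_ℂ +
        ⟪e (T.coeff 1 h), (S ^ k) (e (T.coeff 1 h'))⟫_ℂ) := by
  have hpow : ∀ {A : N →L[ℂ] N}, (∀ x, A (S x) = S (A x)) → ∀ x, A ((S ^ k) x) = (S ^ k) (A x) := by
    intro A hA
    induction k with
    | zero => exact fun x => rfl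
    | succ k ih =>
      intro x
      rw [pow_succ, linearIsometryEquiv_mul_apply, linearIsometryEquiv_mul_apply, ih, hA]
  rw [← hpow hΔS, hΔ, hpow hM, hMe, hMe, map_add, inner_add_left, inner_add_right,
    inner_add_right, ← linearIsometryEquiv_mul_apply (S ^ k) S, ← pow_succ]
  have hlast : ⟪S (e (T.coeff 1 h)), (S ^ (k + 1)) (e (T.coeff 1 h'))⟫_ℂ =
      ⟪e (T.coeff 1 h), (S ^ k) (e (T.coeff 1 h'))⟫_ℂ := by
    rw [pow_succ', linearIsometryEquiv_mul_apply, S.inner_map_map]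
  rw [hlast]
  ring

end DefectCorrelations

/-! ### Multiplication operators on L² of the circle. -/

section CircleModel

open MeasureTheory

variable (H : Type u) [NormedAddCommGroup H] [InnerProductSpace ℂ H]

/-- The space `L²` of the circle with values in `H`. -/
abbrev CircleL2 : Type u := Lp H 2 (AddCircle.haarAddCircle (T := (1 : ℝ)))

/-- Multiplication by the monomial `ζ ^ k`. -/
noncomputable def mulMonomial (k : ℤ) : CircleL2 H →L[ℂ] CircleL2 H :=
  (ContinuousLinearMap.lsmul ℂ ℂ).holderL AddCircle.haarAddCircle ∞ 2 2 (fourierLp ∞ k)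

variable {H}

theorem coeFn_mulMonomial (k : ℤ) (f : CircleL2 H) :
    mulMonomial H k f =ᵐ[AddCircle.haarAddCircle] fun t => fourier k t • f t := by
  have h := (ContinuousLinearMap.lsmul ℂ ℂ).coeFn_holder (r := 2)
    (fourierLp (T := (1 : ℝ)) ∞ k) f
  filter_upwards [h, coeFn_fourierLp (T := (1 : ℝ)) ∞ k] with t h1 h2
  rw [h2] at h1
  exact h1

theorem mulMonomial_mulMonomial (k l : ℤ) (f : CircleL2 H) :
    mulMonomial H k (mulMonomial H l f) = mulMonomial H (k + l) f := by
  refine Lp.ext ?_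
  filter_upwards [coeFn_mulMonomial k (mulMonomial H l f), coeFn_mulMonomial l f,
    coeFn_mulMonomial (k + l) f] with t h1 h2 h3
  rw [h1, h2, h3, smul_smul, fourier_add]

theorem mulMonomial_zero (f : CircleL2 H) : mulMonomial H 0 f = f := by
  refine Lp.ext ?_
  filter_upwards [coeFn_mulMonomial 0 f] with t h1
  rw [h1, fourier_zero, one_smul]

theorem norm_fourier_apply (k : ℤ) (t : AddCircle (1 : ℝ)) : ‖fourier k t‖ = 1 := by
  rw [fourier_apply, Circle.norm_coe]

theorem norm_mulMonomial (k : ℤ) (f : CircleL2 H) : ‖mulMonomial H k f‖ = ‖f‖ := by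
  rw [Lp.norm_def, Lp.norm_def]
  congr 1
  refine eLpNorm_congr_norm_ae ?_
  filter_upwards [coeFn_mulMonomial k f] with t h1
  rw [h1, norm_smul, norm_fourier_apply, one_mul]

variable (H) in
/-- The bilateral shift on `L²`. -/
noncomputable def bilateralShift : CircleL2 H ≃ₗᵢ[ℂ] CircleL2 H where
  toLinearEquiv :=
    LinearEquiv.ofLinearMap (mulMonomial H 1 : CircleL2 H →ₗ[ℂ] CircleL2 H) (mulMonomial H (-1))
      (by ext1 f; exact (mulMonomial_mulMonomial 1 (-1) f).trans (mulMonomial_zero f))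
      (by ext1 f; exact (mulMonomial_mulMonomial (-1) 1 f).trans (mulMonomial_zero f))
  norm_map' := norm_mulMonomial 1

theorem bilateralShift_pow (k : ℕ) (f : CircleL2 H) :
    (bilateralShift H ^ k) f = mulMonomial H k f := by
  induction k with
  | zero => exact (mulMonomial_zero f).symm
  | succ k ih =>
    rw [pow_succ', linearIsometryEquiv_mul_apply, ih]
    refine (mulMonomial_mulMonomial 1 k f).trans ?_
    rw [add_comm]
    rfl

theorem compLpL_bilateralShift (A : H →L[ℂ] H) (f : CircleL2 H) :
    A.compLpL 2 AddCircle.haarAddCircle (bilateralShift H f) =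
      bilateralShift H (A.compLpL 2 AddCircle.haarAddCircle f) := by
  change A.compLpL 2 AddCircle.haarAddCircle (mulMonomial H 1 f) =
    mulMonomial H 1 (A.compLpL 2 AddCircle.haarAddCircle f)
  refine Lp.ext ?_
  filter_upwards [A.coeFn_compLpL (mulMonomial H 1 f), coeFn_mulMonomial 1 f,
    A.coeFn_compLpL f, coeFn_mulMonomial 1 (A.compLpL 2 AddCircle.haarAddCircle f)]
    with t h1 h2 h3 h4
  rw [h1, h2, h4, h3, map_smul]

theorem compLpL_constL (A : H →L[ℂ] H) (h : H) :
    A.compLpL 2 (AddCircle.haarAddCircle (T := (1 : ℝ))) (Lp.constL 2 _ ℂ h) =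
      Lp.constL 2 _ ℂ (A h) := by
  refine Lp.ext ?_
  filter_upwards [A.coeFn_compLpL (Lp.constL 2 (AddCircle.haarAddCircle (T := (1 : ℝ))) ℂ h),
    Lp.coeFn_const (p := 2) (μ := AddCircle.haarAddCircle (T := (1 : ℝ))) h,
    Lp.coeFn_const (p := 2) (μ := AddCircle.haarAddCircle (T := (1 : ℝ))) (A h)] with t h1 h2 h3
  rw [h1]
  exact (congrArg A h2).trans h3.symm

theorem integral_fourier (k : ℕ) :
    ∫ t, fourier (k : ℤ) t ∂(AddCircle.haarAddCircle (T := (1 : ℝ))) = if k = 0 then 1 else 0 := by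
  split_ifs with h
  · simp [h]
  · exact integral_eq_zero_of_add_right_eq_neg (μ := AddCircle.haarAddCircle)
      (fourier_add_half_inv_index (by exact_mod_cast h) one_pos)

/-- The constants form a wandering subspace for the bilateral shift, because the nontrivial
characters have mean zero. -/
theorem inner_constL_pow (k : ℕ) (h h' : H) :
    ⟪Lp.constL 2 (AddCircle.haarAddCircle (T := (1 : ℝ))) ℂ h,
      (bilateralShift H ^ k) (Lp.constL 2 AddCircle.haarAddCircle ℂ h')⟫_ℂ =
      if k = 0 then ⟪h, h'⟫_ℂ else 0 := by
  rw [bilateralShift_pow, L2.inner_def]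
  have : (fun t => ⟪Lp.constL 2 (AddCircle.haarAddCircle (T := (1 : ℝ))) ℂ h t,
      mulMonomial H k (Lp.constL 2 AddCircle.haarAddCircle ℂ h') t⟫_ℂ)
      =ᵐ[AddCircle.haarAddCircle] fun t => fourier (k : ℤ) t * ⟪h, h'⟫_ℂ := by
    filter_upwards [coeFn_mulMonomial k (Lp.constL 2 AddCircle.haarAddCircle ℂ h'),
      Lp.coeFn_const (p := 2) (μ := AddCircle.haarAddCircle (T := (1 : ℝ))) h,
      Lp.coeFn_const (p := 2) (μ := AddCircle.haarAddCircle (T := (1 : ℝ))) h'] with t h1 h2 h3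
    have h2' : Lp.constL 2 (AddCircle.haarAddCircle (T := (1 : ℝ))) ℂ h t = h := h2
    have h3' : Lp.constL 2 (AddCircle.haarAddCircle (T := (1 : ℝ))) ℂ h' t = h' := h3
    rw [h1, h2', h3', inner_smul_right]
  rw [integral_congr_ae this, integral_mul_const, integral_fourier]
  simp

/-- Multiplication by a contractive pencil is a contraction on `L²`. -/
theorem norm_mulPencil_le {T : LinearPencil H H} (hT : T.IsContractive) :
    ‖(T.coeff 0).compLpL 2 (AddCircle.haarAddCircle (T := (1 : ℝ))) +
      (bilateralShift H : CircleL2 H →L[ℂ] CircleL2 H) ∘L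
        (T.coeff 1).compLpL 2 AddCircle.haarAddCircle‖ ≤ 1 := by
  refine ContinuousLinearMap.opNorm_le_bound _ zero_le_one fun f => ?_
  rw [one_mul]
  refine Lp.norm_le_norm_of_ae_le ?_
  have h5 : ∀ g, (bilateralShift H : CircleL2 H →L[ℂ] CircleL2 H) g = mulMonomial H 1 g :=
    fun _ => rfl
  rw [add_apply, ContinuousLinearMap.comp_apply, h5]
  filter_upwards [Lp.coeFn_add ((T.coeff 0).compLpL 2 AddCircle.haarAddCircle f)
      (mulMonomial H 1 ((T.coeff 1).compLpL 2 AddCircle.haarAddCircle f)),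
    (T.coeff 0).coeFn_compLpL f, (T.coeff 1).coeFn_compLpL f,
    coeFn_mulMonomial 1 ((T.coeff 1).compLpL 2 AddCircle.haarAddCircle f)] with t h1 h2 h3 h4
  rw [h1, Pi.add_apply, h4, h3, h2, fourier_one, ← LinearPencil.eval_apply]
  exact ((T.eval _).le_of_opNorm_le (hT _) _).trans_eq (one_mul _)

end CircleModel

/-! ### The outer factor of I - T*T. -/

section Factorization

variable {H : Type u} [NormedAddCommGroup H] [InnerProductSpace ℂ H] [CompleteSpace H]

/-- The identity for the coefficients that is equivalent to `F(ζ)* F(ζ) = I - T(ζ)* T(ζ)`. -/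
theorem isDefectFactor_of_coeff {Y : Type v} [NormedAddCommGroup Y] [InnerProductSpace ℂ Y]
    [CompleteSpace Y] {T : LinearPencil H H} {F : LinearPencil H Y}
    (h0 : ∀ h h', ⟪F.coeff 0 h, F.coeff 0 h'⟫_ℂ + ⟪F.coeff 1 h, F.coeff 1 h'⟫_ℂ =
      ⟪h, h'⟫_ℂ - (⟪T.coeff 0 h, T.coeff 0 h'⟫_ℂ + ⟪T.coeff 1 h, T.coeff 1 h'⟫_ℂ))
    (h1 : ∀ h h', ⟪F.coeff 1 h, F.coeff 0 h'⟫_ℂ = -⟪T.coeff 1 h, T.coeff 0 h'⟫_ℂ) :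
    IsDefectFactor T F := by
  intro ζ
  ext h
  refine ext_inner_left ℂ fun g => ?_
  have h2 : ⟪F.coeff 0 g, F.coeff 1 h⟫_ℂ = -⟪T.coeff 0 g, T.coeff 1 h⟫_ℂ := by
    rw [← inner_conj_symm, h1, map_neg, inner_conj_symm]
  simp only [ContinuousLinearMap.comp_apply, sub_apply, ContinuousLinearMap.id_apply,
    inner_sub_right, ContinuousLinearMap.adjoint_inner_right, LinearPencil.eval_apply,
    inner_add_left, inner_add_right, inner_smul_left, inner_smul_right]
  -- `h0`, `h1` and `h2` match the coefficients of 1, ζ̄ and ζ; the last summand accounts for ζζ̄ =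
  -- 1.
  linear_combination h0 g h + (starRingEnd ℂ ζ) * h1 g h + ζ * h2 +
    (⟪F.coeff 1 g, F.coeff 1 h⟫_ℂ + ⟪T.coeff 1 g, T.coeff 1 h⟫_ℂ) * Circle.mul_conj_coe ζ

theorem IsDefectFactor.norm_eval_le_one {Y : Type v} [NormedAddCommGroup Y]
    [InnerProductSpace ℂ Y] [CompleteSpace Y] {T : LinearPencil H H} {F : LinearPencil H Y}
    (hF : IsDefectFactor T F) (ζ : Circle) : ‖F.eval ζ‖ ≤ 1 := by
  refine ContinuousLinearMap.opNorm_le_bound _ zero_le_one fun h => ?_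
  rw [one_mul, ← sq_le_sq₀ (norm_nonneg _) (norm_nonneg _)]
  linarith [hF.norm_sq ζ h, sq_nonneg ‖T.eval ζ h‖]

/-- The operator Fejér–Riesz theorem for the defect of a contractive linear pencil. -/
theorem exists_isOuterFactor [TopologicalSpace.SeparableSpace H] (T : LinearPencil H H)
    (hT : T.IsContractive) :
    ∃ (Y : Type u) (_ : NormedAddCommGroup Y) (_ : InnerProductSpace ℂ Y) (_ : CompleteSpace Y)
      (_ : TopologicalSpace.SeparableSpace Y) (F : LinearPencil H Y), IsOuterFactor T F := by
  set S := bilateralShift H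
  set M : CircleL2 H →L[ℂ] CircleL2 H := (T.coeff 0).compLpL 2 AddCircle.haarAddCircle +
    (S : CircleL2 H →L[ℂ] CircleL2 H) ∘L (T.coeff 1).compLpL 2 AddCircle.haarAddCircle with hMdef
  set e : H →L[ℂ] CircleL2 H := MeasureTheory.Lp.constL 2 AddCircle.haarAddCircle ℂ
  have hMapp : ∀ f, M f = (T.coeff 0).compLpL 2 AddCircle.haarAddCircle f +
    S ((T.coeff 1).compLpL 2 AddCircle.haarAddCircle f) := fun _ => rfl
  have hMS : ∀ f, M (S f) = S (M f) := fun f => by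
    rw [hMapp, hMapp, compLpL_bilateralShift, compLpL_bilateralShift, map_add]
  have hMe : ∀ h, M (e h) = e (T.coeff 0 h) + S (e (T.coeff 1 h)) := fun h => by
    rw [hMapp, compLpL_constL, compLpL_constL]
  obtain ⟨Δ, hΔS, hΔ⟩ := exists_defectOperator S M (norm_mulPencil_le hT) hMS
  have hcorr := inner_pow_defect T hMS hΔS hΔ hMe
  have hshift : ∀ h h', ⟪S (e h), e h'⟫_ℂ = 0 := fun h h' => by
    have h1 := inner_constL_pow 1 h' h
    rw [pow_one, if_neg one_ne_zero] at h1
    rw [← inner_conj_symm, h1, map_zero]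
  -- I - T*T has Fourier coefficients only at -1, 0 and 1, so every term of `hcorr` is zero for
  -- these k.
  have hb : ∀ k, 2 ≤ k → ∀ h h', ⟪(Δ ∘L e) h, (S ^ k) ((Δ ∘L e) h')⟫_ℂ = 0 := by
    intro k hk h h'
    obtain ⟨k, rfl⟩ : ∃ i, k = i + 2 := ⟨k - 2, by omega⟩
    refine (hcorr (k + 2) h h').trans ?_
    rw [inner_constL_pow, inner_constL_pow, inner_constL_pow, inner_constL_pow, pow_succ',
      linearIsometryEquiv_mul_apply, S.inner_map_map, inner_constL_pow]
    simp
  have hF : IsDefectFactor T (woldPencil hb) := by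
    refine isDefectFactor_of_coeff (fun h h' => ?_) fun h h' => ?_
    · rw [woldPencil_inner hb]
      refine (hcorr 0 h h').trans ?_
      rw [inner_constL_pow, inner_constL_pow, inner_constL_pow, inner_constL_pow]
      simp only [pow_zero, zero_add, if_pos, one_ne_zero, if_false, add_zero]
      congr 2
      exact (congrArg _ (hshift _ _)).trans (add_zero _)
    · rw [woldPencil_inner_one_zero hb]
      have h1 := hcorr 1 h h'
      rw [inner_constL_pow, inner_constL_pow, inner_constL_pow, inner_constL_pow, pow_one,
        S.inner_map_map] at h1
      have h2 := inner_constL_pow 0 (T.coeff 1 h) (T.coeff 0 h')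
      rw [if_pos rfl, pow_zero] at h2
      refine h1.trans ?_
      simp only [one_ne_zero, if_false, OfNat.ofNat_ne_zero, Nat.reduceAdd, zero_add, add_zero,
        zero_sub]
      exact congrArg _ h2
  have ho : IsOuter (woldPencil hb).eval :=
    isOuter_of_approx (fun z hz => LinearPencil.norm_eval_le_one_of_circle hF.norm_eval_le_one
      (mem_ball_zero_iff.1 hz).le) (woldPencil_approx hb)
  exact ⟨wanderingSpace S (Δ ∘L e), inferInstance, inferInstance, inferInstance,
    -- The wandering space is separable because F₀ maps the separable space H densely into it.
    ho.denseRange_coeff_zero.separableSpace ((woldPencil hb).coeff 0).continuous, woldPencil hb,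
    ho, hF⟩

end Factorization

end PencilDilation

theorem mainTheorem3 {H : Type u} [NormedAddCommGroup H] [InnerProductSpace ℂ H]
    [CompleteSpace H] [TopologicalSpace.SeparableSpace H]
    (T : PencilDilation.LinearPencil H H) (hT : T.IsContractive) :
    (∃ (Y : Type u) (_ : NormedAddCommGroup Y) (_ : InnerProductSpace ℂ Y) (_ : CompleteSpace Y)
        (_ : TopologicalSpace.SeparableSpace Y) (F : PencilDilation.LinearPencil H Y),
        PencilDilation.IsOuterFactor T F) ∧
      ∀ (Y : Type v) [NormedAddCommGroup Y] [InnerProductSpace ℂ Y] [CompleteSpace Y]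
        [TopologicalSpace.SeparableSpace Y] (F : PencilDilation.LinearPencil H Y),
        PencilDilation.IsOuterFactor T F →
        PencilDilation.IsMinimalUnitaryDilation
            (PencilDilation.embH Y H
              (PencilDilation.DefectSpace (PencilDilation.isomDilation T F)))
            T (PencilDilation.unitaryDilation T F) ∧
          PencilDilation.IsMinimalUniformUnitaryDilation
            (PencilDilation.embH Y H
              (PencilDilation.DefectSpace (PencilDilation.isomDilation T F)))
            T (PencilDilation.unitaryDilation T F) :=
  ⟨PencilDilation.exists_isOuterFactor T hT, fun _ _ _ _ _ _ hF =>
    PencilDilation.IsDefectFactor.isMinimal hF.2 hT hF.1.denseRange_coeff_zero⟩
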